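/- Let $k$ be a field of characteristic different from $2$ and let $n\ge 1$. Let $E(n)$ be the Hopf algebra over $k$ generated by $c,x_1,\dots,x_n$ with relations $c^2=1$, $x_i^2=0$, $cx_i=-x_ic$, $x_ix_j=-x_jx_i$ ($i<j$), coproduct $\Delta(c)=c\otimes c$, $\Delta(x_i)=1\otimes x_i+x_i\otimes c$, counit $\varepsilon(c)=1$, $\varepsilon(x_i)=0$ and antipode $S(c)=c$, $S(x_i)=cx_i$. Let $\mathcal U$ be the set of coquasi-triangular structures of $E(n)$, i.e. of convolution invertible linear maps $r\colon E(n)\otimes E(n)\to k$ with $r(ab\otimes d)=\sum r(a\otimes d_{(1)})r(b\otimes d_{(2)})$, $r(a\otimes bd)=\sum r(a_{(1)}\otimes d)r(a_{(2)}\otimes b)$ and $\sum r(a_{(1)}\otimes b_{(1)})a_{(2)}b_{(2)}=\sum b_{(1)}a_{(1)}r(a_{(2)}\otimes b_{(2)})$ for all $a,b,d\in E(n)$. Let $Z_L(E(n))$ be the group, under convolution, of lazy cocycles, i.e. of convolution invertible linear maps $\sigma\colon E(n)\otimes E(n)\to k$ with $\sum \sigma(g_{(1)}\otimes h_{(1)})\sigma(g_{(2)}h_{(2)}\otimes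 m)=\sum \sigma(h_{(1)}\otimes m_{(1)})\sigma(g\otimes h_{(2)}m_{(2)})$ and $\sum\sigma(h_{(1)}\otimes l_{(1)})h_{(2)}l_{(2)}=\sum h_{(1)}l_{(1)}\sigma(h_{(2)}\otimes l_{(2)})$ for all $g,h,l,m\in E(n)$. It acts on $\mathcal U$ by $\sigma\cdot r=(\sigma\tau)*r*\sigma^{-1}$, where $\tau$ is the flip and $*$ is convolution. Then $r\mapsto A_r:=(r(x_i\otimes x_j))_{i,j}$ is a bijection from $\mathcal U$ onto $M_n(k)$, and the map sending the orbit of $r$ to the skew-symmetric part $\frac12(A_r-A_r^{t})$ of $A_r$ is a well-defined bijection from the set of $Z_L(E(n))$-orbits on $\mathcal U$ onto the set of skew-symmetric $n\times n$ matrices over $k$. -/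

import Mathlib

open scoped TensorProduct
open WithConv

noncomputable section

/-! ### Lazy cocycles and coquasi-triangular structures of a bialgebra -/

namespace CQT

section Pull

variable {k C D F : Type*} [CommRing k]
  [AddCommGroup C] [Module k C] [Coalgebra k C]
  [AddCommGroup D] [Module k D] [Coalgebra k D]
  [AddCommGroup F] [Module k F] [Coalgebra k F]

/-- Precomposition with a coalgebra map `φ : C → D`, as a map of convolution algebras
`Hom(D, k) → Hom(C, k)`. -/
def pull (φ : C →ₗc[k] D) : WithConv (D →ₗ[k] k) →* WithConv (C →ₗ[k] k) where
  toFun f := toConv (f.ofConv ∘ₗ φ.toLinearMap)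
  map_one' := by
    ext x
    simp [LinearMap.convOne_def]
  map_mul' f g := congrArg toConv (LinearMap.convMul_comp_coalgHom_distrib f g φ)

theorem pull_apply (φ : C →ₗc[k] D) (f : WithConv (D →ₗ[k] k)) (x : C) :
    pull φ f x = f (φ x) := rfl

theorem pull_pull (φ : C →ₗc[k] D) (ψ : D →ₗc[k] F) (f : WithConv (F →ₗ[k] k)) :
    pull φ (pull ψ f) = pull (ψ.comp φ) f := rfl

end Pull

section Basic

variable (k H : Type*) [CommRing k] [Ring H] [Bialgebra k H]

/-- The convolution algebra of linear forms on `H ⊗ H`: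
`(f * g)(a ⊗ b) = ∑ f(a₁ ⊗ b₁) g(a₂ ⊗ b₂)`, with unit `ε ⊗ ε`. -/
abbrev Form2 : Type _ := WithConv (H ⊗[k] H →ₗ[k] k)

/-- The flip `a ⊗ b ↦ b ⊗ a`, as a coalgebra map. -/
def flip : H ⊗[k] H →ₗc[k] H ⊗[k] H := (Bialgebra.TensorProduct.comm k H H : _ →ₗc[k] _)

/-- `(a ⊗ b) ⊗ c ↦ ε(c) a ⊗ b`. -/
def p12 : (H ⊗[k] H) ⊗[k] H →ₗc[k] H ⊗[k] H :=
  (Coalgebra.TensorProduct.rid k k (H ⊗[k] H) : _ →ₗc[k] _).comp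
    (Coalgebra.TensorProduct.map (CoalgHom.id k (H ⊗[k] H)) (Coalgebra.counitCoalgHom k H))

/-- The cyclic permutation `(a ⊗ b) ⊗ c ↦ (b ⊗ c) ⊗ a`. -/
def rot : (H ⊗[k] H) ⊗[k] H →ₗc[k] (H ⊗[k] H) ⊗[k] H :=
  (Bialgebra.TensorProduct.comm k H (H ⊗[k] H) :
      H ⊗[k] (H ⊗[k] H) →ₗc[k] (H ⊗[k] H) ⊗[k] H).comp
    (Coalgebra.TensorProduct.assoc k k H H H :
      (H ⊗[k] H) ⊗[k] H →ₗc[k] H ⊗[k] (H ⊗[k] H))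

/-- The transposition `(a ⊗ b) ⊗ c ↦ (b ⊗ a) ⊗ c`. -/
def swp : (H ⊗[k] H) ⊗[k] H →ₗc[k] (H ⊗[k] H) ⊗[k] H :=
  Coalgebra.TensorProduct.map (flip k H) (CoalgHom.id k H)

/-- `(a ⊗ b) ⊗ c ↦ ε(a) b ⊗ c`. -/
def p23 : (H ⊗[k] H) ⊗[k] H →ₗc[k] H ⊗[k] H := (p12 k H).comp (rot k H)

/-- `(a ⊗ b) ⊗ c ↦ ε(b) a ⊗ c`. -/
def p13 : (H ⊗[k] H) ⊗[k] H →ₗc[k] H ⊗[k] H := (p23 k H).comp (swp k H)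

/-- `(a ⊗ b) ⊗ c ↦ a b ⊗ c`. -/
def m12 : (H ⊗[k] H) ⊗[k] H →ₗc[k] H ⊗[k] H :=
  Coalgebra.TensorProduct.map (Bialgebra.mulCoalgHom k H) (CoalgHom.id k H)

/-- `(a ⊗ b) ⊗ c ↦ a ⊗ b c`. -/
def m23 : (H ⊗[k] H) ⊗[k] H →ₗc[k] H ⊗[k] H :=
  (Coalgebra.TensorProduct.map (CoalgHom.id k H) (Bialgebra.mulCoalgHom k H)).comp
    (Coalgebra.TensorProduct.assoc k k H H H :
      (H ⊗[k] H) ⊗[k] H →ₗc[k] H ⊗[k] (H ⊗[k] H))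

variable {k H}

@[simp] theorem flip_tmul (a b : H) : flip k H (a ⊗ₜ b) = b ⊗ₜ a := rfl
@[simp] theorem rot_tmul (a b c : H) : rot k H ((a ⊗ₜ b) ⊗ₜ c) = (b ⊗ₜ c) ⊗ₜ a := rfl
@[simp] theorem swp_tmul (a b c : H) : swp k H ((a ⊗ₜ b) ⊗ₜ c) = (b ⊗ₜ a) ⊗ₜ c := rfl
@[simp] theorem p12_tmul (a b c : H) :
    p12 k H ((a ⊗ₜ b) ⊗ₜ c) = Coalgebra.counit (R := k) c • (a ⊗ₜ b) := rfl
@[simp] theorem p23_tmul (a b c : H) :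
    p23 k H ((a ⊗ₜ b) ⊗ₜ c) = Coalgebra.counit (R := k) a • (b ⊗ₜ c) := rfl
@[simp] theorem p13_tmul (a b c : H) :
    p13 k H ((a ⊗ₜ b) ⊗ₜ c) = Coalgebra.counit (R := k) b • (a ⊗ₜ c) := rfl
@[simp] theorem m12_tmul (a b c : H) : m12 k H ((a ⊗ₜ b) ⊗ₜ c) = (a * b) ⊗ₜ c := rfl
@[simp] theorem m23_tmul (a b c : H) : m23 k H ((a ⊗ₜ b) ⊗ₜ c) = a ⊗ₜ (b * c) := rfl

/-- A linear form on `H ⊗ H` seen with values in `k 1 ⊆ H`, as an element of the convolution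
algebra `Hom(H ⊗ H, H)`. -/
def scal : Form2 k H →* WithConv (H ⊗[k] H →ₗ[k] H) where
  toFun f := toConv (Algebra.linearMap k H ∘ₗ f.ofConv)
  map_one' := by
    ext a b
    simp [LinearMap.convOne_def]
  map_mul' f g := congrArg toConv (LinearMap.algHom_comp_convMul_distrib (Algebra.ofId k H) f g)

/-- The product `a ⊗ b ↦ a b` as an element of the convolution algebra `Hom(H ⊗ H, H)`. -/
def prod : WithConv (H ⊗[k] H →ₗ[k] H) := toConv (LinearMap.mul' k H)

/-- The opposite product `a ⊗ b ↦ b a`. -/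
def prodOp : WithConv (H ⊗[k] H →ₗ[k] H) :=
  toConv (LinearMap.mul' k H ∘ₗ (flip k H).toLinearMap)

/-- The left `2`-cocycle condition
`∑ σ(g₁ ⊗ h₁) σ(g₂ h₂ ⊗ m) = ∑ σ(h₁ ⊗ m₁) σ(g ⊗ h₂ m₂)`, as an identity in the convolution
algebra `Hom(H ⊗ H ⊗ H, k)`. -/
def IsLeftCocycle (σ : Form2 k H) : Prop :=
  pull (p12 k H) σ * pull (m12 k H) σ = pull (p23 k H) σ * pull (m23 k H) σ

/-- The laziness condition `∑ σ(h₁ ⊗ l₁) h₂ l₂ = ∑ h₁ l₁ σ(h₂ ⊗ l₂)`. -/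
def IsLazy (σ : Form2 k H) : Prop := scal σ * prod = prod * scal σ

/-- The identities of a coquasi-triangular structure:
`r(a b ⊗ c) = ∑ r(a ⊗ c₁) r(b ⊗ c₂)`, `r(a ⊗ b c) = ∑ r(a₁ ⊗ c) r(a₂ ⊗ b)` and
`∑ r(a₁ ⊗ b₁) a₂ b₂ = ∑ b₁ a₁ r(a₂ ⊗ b₂)`. -/
structure IsCoquasiTriangular (r : Form2 k H) : Prop where
  mul_left : pull (m12 k H) r = pull (p13 k H) r * pull (p23 k H) r
  mul_right : pull (m23 k H) r = pull (p13 k H) r * pull (p12 k H) r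
  comm : scal r * prod = prodOp * scal r

/-! ### Lazy cocycles form a group, acting on coquasi-triangular structures -/

theorem ext3 {C : Type*} [AddCommGroup C] [Module k C] [Coalgebra k C]
    {φ ψ : (H ⊗[k] H) ⊗[k] H →ₗc[k] C}
    (h : ∀ a b c : H, φ ((a ⊗ₜ b) ⊗ₜ c) = ψ ((a ⊗ₜ b) ⊗ₜ c)) : φ = ψ := by
  have : φ.toLinearMap = ψ.toLinearMap := TensorProduct.ext_threefold h
  ext x
  exact LinearMap.congr_fun this x

theorem p12_apply (x : H ⊗[k] H) (c : H) :
    p12 k H (x ⊗ₜ c) = Coalgebra.counit (R := k) c • x := rfl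

theorem scal_apply (f : Form2 k H) (x : H ⊗[k] H) : scal f x = algebraMap k H (f x) := rfl

theorem pull_p12_mul (p : H ⊗[k] H →ₗc[k] H) (u f : Form2 k H) (x : H ⊗[k] H) (c : H) :
    (pull (p12 k H) u * pull (Coalgebra.TensorProduct.map p (CoalgHom.id k H)) f) (x ⊗ₜ c) =
      f ((scal u * toConv p.toLinearMap) x ⊗ₜ c) := by
  rw [(Coalgebra.Repr.arbitrary k x).convMul_apply,
    ((Coalgebra.Repr.arbitrary k x).tmul (Coalgebra.Repr.arbitrary k c)).convMul_apply]
  simp only [Coalgebra.Repr.tmul_index, Coalgebra.Repr.tmul_left, Coalgebra.Repr.tmul_right,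
    Finset.sum_product, pull_apply, p12_apply, TensorProduct.sum_tmul, map_sum,
    Coalgebra.TensorProduct.map_tmul]
  refine Finset.sum_congr rfl fun i _ => ?_
  conv_rhs => rw [← Coalgebra.sum_counit_smul (Coalgebra.Repr.arbitrary k c)]
  simp [scal_apply, TensorProduct.tmul_sum, ← Algebra.smul_def,
    ← TensorProduct.smul_tmul', mul_assoc]

theorem pull_mul_p12 (q : H ⊗[k] H →ₗc[k] H) (u f : Form2 k H) (x : H ⊗[k] H) (c : H) :
    (pull (Coalgebra.TensorProduct.map q (CoalgHom.id k H)) f * pull (p12 k H) u) (x ⊗ₜ c) =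
      f ((toConv q.toLinearMap * scal u) x ⊗ₜ c) := by
  rw [(Coalgebra.Repr.arbitrary k x).convMul_apply,
    ((Coalgebra.Repr.arbitrary k x).tmul (Coalgebra.Repr.arbitrary k c)).convMul_apply]
  simp only [Coalgebra.Repr.tmul_index, Coalgebra.Repr.tmul_left, Coalgebra.Repr.tmul_right,
    Finset.sum_product, pull_apply, p12_apply, TensorProduct.sum_tmul, map_sum,
    Coalgebra.TensorProduct.map_tmul]
  refine Finset.sum_congr rfl fun i _ => ?_
  have hc : ∑ j ∈ (Coalgebra.Repr.arbitrary k c).index,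
      Coalgebra.counit (R := k) ((Coalgebra.Repr.arbitrary k c).right j) •
        (Coalgebra.Repr.arbitrary k c).left j = c := by
    have h := congrArg (TensorProduct.rid k H)
      (Coalgebra.sum_tmul_counit_eq (Coalgebra.Repr.arbitrary k c))
    simp only [map_sum, TensorProduct.rid_tmul, one_smul] at h
    exact h
  conv_rhs => rw [← hc]
  simp [scal_apply, TensorProduct.tmul_sum, ← Algebra.commutes, ← Algebra.smul_def,
    ← TensorProduct.smul_tmul', mul_comm (f.ofConv _), mul_assoc]

/-- If `u * p = q * u` in `Hom(H ⊗ H, H)` for coalgebra maps `p`, `q`, then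
`u ⊗ ε` intertwines `f ∘ (p ⊗ id)` and `f ∘ (q ⊗ id)`. -/
theorem intertwine {p q : H ⊗[k] H →ₗc[k] H} {u : Form2 k H}
    (h : scal u * toConv p.toLinearMap = toConv q.toLinearMap * scal u) (f : Form2 k H) :
    pull (p12 k H) u * pull (Coalgebra.TensorProduct.map p (CoalgHom.id k H)) f =
      pull (Coalgebra.TensorProduct.map q (CoalgHom.id k H)) f * pull (p12 k H) u := by
  apply WithConv.ext
  refine TensorProduct.ext' fun x c => ?_
  exact (pull_p12_mul p u f x c).trans ((congrArg (fun g : WithConv (H ⊗[k] H →ₗ[k] H) =>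
    f (g x ⊗ₜ c)) h).trans (pull_mul_p12 q u f x c).symm)

theorem IsLazy.comm12 {σ : Form2 k H} (h : IsLazy σ) (f : Form2 k H) :
    Commute (pull (p12 k H) σ) (pull (m12 k H) f) :=
  intertwine (p := Bialgebra.mulCoalgHom k H) (q := Bialgebra.mulCoalgHom k H) h f

theorem IsLazy.comm23 {σ : Form2 k H} (h : IsLazy σ) (f : Form2 k H) :
    Commute (pull (p23 k H) σ) (pull (m23 k H) f) := by
  have h1 := (h.comm12 (pull (flip k H) f)).map (pull (rot k H))
  rw [pull_pull, pull_pull, pull_pull] at h1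
  have e : (flip k H).comp ((m12 k H).comp (rot k H)) = m23 k H :=
    ext3 fun a b c => by simp
  rwa [e] at h1

theorem IsCoquasiTriangular.swap {r : Form2 k H} (h : IsCoquasiTriangular r) (f : Form2 k H) :
    pull (p12 k H) r * pull (m12 k H) f =
      pull ((m12 k H).comp (swp k H)) f * pull (p12 k H) r := by
  have h1 := intertwine (p := Bialgebra.mulCoalgHom k H)
    (q := (Bialgebra.mulCoalgHom k H).comp (flip k H)) h.comm f
  have e : Coalgebra.TensorProduct.map ((Bialgebra.mulCoalgHom k H).comp (flip k H))
      (CoalgHom.id k H) = (m12 k H).comp (swp k H) := ext3 fun a b c => by simp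
  rwa [e] at h1

variable (k H) in
/-- The group `Z_L(H)` of convolution invertible lazy left `2`-cocycles, under convolution. -/
def lazyCocycles : Subgroup (Form2 k H)ˣ where
  carrier := {σ | IsLeftCocycle (σ : Form2 k H) ∧ IsLazy (σ : Form2 k H)}
  one_mem' := ⟨by simp [IsLeftCocycle], by simp [IsLazy]⟩
  mul_mem' {σ τ} hσ hτ := by
    refine ⟨?_, ?_⟩
    · have h1 := (hτ.2.comm12 σ).eq
      have h2 := (hτ.2.comm23 σ).eq
      have h3 := hσ.1
      have h4 := hτ.1
      unfold IsLeftCocycle at *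
      rw [Units.val_mul, map_mul, map_mul, map_mul, map_mul, mul_assoc,
        ← mul_assoc (pull (p12 k H) _) (pull (m12 k H) _), h1, mul_assoc, h4, ← mul_assoc, h3,
        mul_assoc, ← mul_assoc (pull (m23 k H) _), ← h2]
      simp only [mul_assoc]
    · have h1 : Commute (scal (σ : Form2 k H)) prod := hσ.2
      have h2 : Commute (scal (τ : Form2 k H)) prod := hτ.2
      have h3 := h1.mul_left h2
      rw [← map_mul] at h3
      exact h3
  inv_mem' {σ} hσ := by
    refine ⟨?_, ?_⟩
    · have h1 : Units.map (pull (p12 k H)) σ * Units.map (pull (m12 k H)) σ =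
          Units.map (pull (m12 k H)) σ * Units.map (pull (p12 k H)) σ :=
        Units.ext (hσ.2.comm12 σ).eq
      have h2 : Units.map (pull (p23 k H)) σ * Units.map (pull (m23 k H)) σ =
          Units.map (pull (m23 k H)) σ * Units.map (pull (p23 k H)) σ :=
        Units.ext (hσ.2.comm23 σ).eq
      have h3 : Units.map (pull (p12 k H)) σ * Units.map (pull (m12 k H)) σ =
          Units.map (pull (p23 k H)) σ * Units.map (pull (m23 k H)) σ := Units.ext hσ.1
      rw [h1, h2] at h3
      have h4 := congrArg (fun u => u⁻¹) h3
      simp only [mul_inv_rev, ← map_inv] at h4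
      exact congrArg Units.val h4
    · have h1 : Commute ((Units.map scal σ : (WithConv (H ⊗[k] H →ₗ[k] H))ˣ) :
          WithConv (H ⊗[k] H →ₗ[k] H)) prod := hσ.2
      have h2 := h1.units_inv_left
      rw [← map_inv] at h2
      exact h2

variable (k H) in
/-- The set `𝒰` of coquasi-triangular structures of `H`: the convolution invertible linear forms
`r` on `H ⊗ H` satisfying the identities of a coquasi-triangular structure. -/
def CoquasiTriangular : Type _ := {r : (Form2 k H)ˣ // IsCoquasiTriangular (r : Form2 k H)}

theorem group_hex1 {G : Type*} [Group G]
    {s12 s13 s23 s31 s32 A B C D E F R r13 r23 : G}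
    (h1 : s12 * A = s23 * B) (h2 : s31 * C = s12 * D) (h3 : s13 * E = s32 * F)
    (h4 : R = r13 * r23) (h5 : r13 * E = C * r13) (h6 : r23 * B = F * r23)
    (h8 : Commute s12 (D * R * A⁻¹)) :
    D * R * A⁻¹ = (s31 * r13 * s13⁻¹) * (s32 * r23 * s23⁻¹) := by
  have e0 : D * R * A⁻¹ = s12 * (D * R * A⁻¹) * s12⁻¹ := by
    rw [h8.eq, mul_inv_cancel_right]
  have e2 : s12 * (D * R * A⁻¹) * s12⁻¹ = (s12 * D) * R * (s12 * A)⁻¹ := by group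
  have e3 : s32 = s13 * E * F⁻¹ := by rw [h3]; group
  have e4 : C = r13 * E * r13⁻¹ := by rw [h5]; group
  have e5 : F = r23 * B * r23⁻¹ := by rw [h6]; group
  rw [e0, e2, h1, ← h2, h4, e3, e4, e5]
  group

theorem group_hex2 {G : Type*} [Group G]
    {s12 s13 s23 s31 s21 A B D K L N R r13 r12 : G}
    (h1 : s12 * A = s23 * B) (h2 : s23 * D = s31 * K) (h3 : s21 * N = s13 * L)
    (h4 : R = r13 * r12) (h5 : r13 * L = K * r13) (h6 : r12 * A = N * r12)
    (h8 : Commute s23 (D * R * B⁻¹)) :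
    D * R * B⁻¹ = (s31 * r13 * s13⁻¹) * (s21 * r12 * s12⁻¹) := by
  have e0 : D * R * B⁻¹ = s23 * (D * R * B⁻¹) * s23⁻¹ := by
    rw [h8.eq, mul_inv_cancel_right]
  have e2 : s23 * (D * R * B⁻¹) * s23⁻¹ = (s23 * D) * R * (s23 * B)⁻¹ := by group
  have e3 : s21 = s13 * L * N⁻¹ := by rw [← h3]; group
  have e4 : K = r13 * L * r13⁻¹ := by rw [h5]; group
  have e5 : N = r12 * A * r12⁻¹ := by rw [h6]; group
  rw [e0, e2, ← h1, h2, h4, e3, e4, e5]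
  group

/-- The twist `(σ ∘ τ) * r * σ⁻¹` of `r` by `σ`, where `τ` is the flip. -/
def twist (σ r : (Form2 k H)ˣ) : (Form2 k H)ˣ := Units.map (pull (flip k H)) σ * r * σ⁻¹

/-- `Units.map` of `pull`. -/
abbrev upull {C : Type*} [AddCommGroup C] [Module k C] [Coalgebra k C]
    (φ : C →ₗc[k] H ⊗[k] H) : (Form2 k H)ˣ →* (WithConv (C →ₗ[k] k))ˣ := Units.map (pull φ)

theorem upull_twist {C : Type*} [AddCommGroup C] [Module k C] [Coalgebra k C]
    (φ : C →ₗc[k] H ⊗[k] H) (σ r : (Form2 k H)ˣ) :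
    upull φ (twist σ r) = upull ((flip k H).comp φ) σ * upull φ r * (upull φ σ)⁻¹ := by
  rw [twist, map_mul, map_mul, map_inv]
  rfl

theorem cocycle_pull {σ : (Form2 k H)ˣ} (hσ : σ ∈ lazyCocycles k H)
    (ρ : (H ⊗[k] H) ⊗[k] H →ₗc[k] (H ⊗[k] H) ⊗[k] H)
    {a b c d : (H ⊗[k] H) ⊗[k] H →ₗc[k] H ⊗[k] H}
    (ha : (p12 k H).comp ρ = a) (hb : (m12 k H).comp ρ = b)
    (hc : (p23 k H).comp ρ = c) (hd : (m23 k H).comp ρ = d) :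
    upull a σ * upull b σ = upull c σ * upull d σ := by
  subst ha hb hc hd
  have h := congrArg (pull ρ) hσ.1
  rw [map_mul, map_mul] at h
  exact Units.ext h

theorem swap_pull {r : (Form2 k H)ˣ} (hr : IsCoquasiTriangular (r : Form2 k H))
    (f : (Form2 k H)ˣ) (ρ : (H ⊗[k] H) ⊗[k] H →ₗc[k] (H ⊗[k] H) ⊗[k] H)
    {a b c : (H ⊗[k] H) ⊗[k] H →ₗc[k] H ⊗[k] H}
    (ha : (p12 k H).comp ρ = a) (hb : (m12 k H).comp ρ = b)
    (hc : ((m12 k H).comp (swp k H)).comp ρ = c) :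
    upull a r * upull b f = upull c f * upull a r := by
  subst ha hb hc
  have h := congrArg (pull ρ) (hr.swap (f : Form2 k H))
  rw [map_mul, map_mul] at h
  exact Units.ext h

theorem swap_pull_flip {r : (Form2 k H)ˣ} (hr : IsCoquasiTriangular (r : Form2 k H))
    (f : (Form2 k H)ˣ) (ρ : (H ⊗[k] H) ⊗[k] H →ₗc[k] (H ⊗[k] H) ⊗[k] H)
    {a b c : (H ⊗[k] H) ⊗[k] H →ₗc[k] H ⊗[k] H}
    (ha : (p12 k H).comp ρ = a) (hb : (flip k H).comp ((m12 k H).comp ρ) = b)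
    (hc : (flip k H).comp (((m12 k H).comp (swp k H)).comp ρ) = c) :
    upull a r * upull b f = upull c f * upull a r := by
  subst ha hb hc
  exact swap_pull hr (upull (flip k H) f) ρ rfl rfl rfl

theorem twist_isCoquasiTriangular {σ r : (Form2 k H)ˣ} (hσ : σ ∈ lazyCocycles k H)
    (hr : IsCoquasiTriangular (r : Form2 k H)) :
    IsCoquasiTriangular (twist σ r : Form2 k H) := by
  have hR1 : upull (m12 k H) r = upull (p13 k H) r * upull (p23 k H) r := Units.ext hr.mul_left
  have hR2 : upull (m23 k H) r = upull (p13 k H) r * upull (p12 k H) r := Units.ext hr.mul_right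
  have hC : upull (p12 k H) σ * upull (m12 k H) σ = upull (p23 k H) σ * upull (m23 k H) σ :=
    Units.ext hσ.1
  refine ⟨?_, ?_, ?_⟩
  · have h8 : Commute (upull (p12 k H) σ) (upull (m12 k H) (twist σ r)) :=
      Units.ext (hσ.2.comm12 (twist σ r : (Form2 k H)ˣ)).eq
    have key : upull (m12 k H) (twist σ r) =
        upull (p13 k H) (twist σ r) * upull (p23 k H) (twist σ r) := by
      rw [upull_twist] at h8
      simp only [upull_twist]
      let ρ := (swp k H).comp ((rot k H).comp (rot k H))
      refine group_hex1 (C := upull ((m12 k H).comp ((rot k H).comp (rot k H))) σ)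
        (E := upull ((m12 k H).comp ρ) σ) (F := upull ((m23 k H).comp ρ) σ)
        hC ?_ ?_ hR1 ?_ ?_ h8
      · exact cocycle_pull hσ ((rot k H).comp (rot k H))
          (ext3 fun a b c => by simp) (ext3 fun a b c => by simp)
          (ext3 fun a b c => by simp) (ext3 fun a b c => by simp)
      · exact cocycle_pull hσ ρ
          (ext3 fun a b c => by simp [ρ]) (ext3 fun a b c => by simp [ρ])
          (ext3 fun a b c => by simp [ρ]) (ext3 fun a b c => by simp [ρ])
      · exact swap_pull hr σ ρ
          (ext3 fun a b c => by simp [ρ]) (ext3 fun a b c => by simp [ρ])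
          (ext3 fun a b c => by simp [ρ])
      · exact swap_pull_flip hr σ (rot k H)
          (ext3 fun a b c => by simp) (ext3 fun a b c => by simp)
          (ext3 fun a b c => by simp [ρ])
    exact congrArg Units.val key
  · have h8 : Commute (upull (p23 k H) σ) (upull (m23 k H) (twist σ r)) :=
      Units.ext (hσ.2.comm23 (twist σ r : (Form2 k H)ˣ)).eq
    have key : upull (m23 k H) (twist σ r) =
        upull (p13 k H) (twist σ r) * upull (p12 k H) (twist σ r) := by
      rw [upull_twist] at h8
      simp only [upull_twist]
      let ρ := (swp k H).comp ((rot k H).comp (rot k H))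
      refine group_hex2 (K := upull ((m23 k H).comp (rot k H)) σ)
        (L := upull ((m23 k H).comp (swp k H)) σ) (N := upull ((m12 k H).comp (swp k H)) σ)
        hC ?_ ?_ hR2 ?_ ?_ h8
      · exact cocycle_pull hσ (rot k H)
          (ext3 fun a b c => by simp) (ext3 fun a b c => by simp)
          (ext3 fun a b c => by simp) (ext3 fun a b c => by simp)
      · exact cocycle_pull hσ (swp k H)
          (ext3 fun a b c => by simp) (ext3 fun a b c => by simp)
          (ext3 fun a b c => by simp) (ext3 fun a b c => by simp)
      · exact swap_pull_flip hr σ ρ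
          (ext3 fun a b c => by simp [ρ]) (ext3 fun a b c => by simp [ρ])
          (ext3 fun a b c => by simp [ρ])
      · exact swap_pull hr σ (CoalgHom.id k _)
          (ext3 fun a b c => by simp) (ext3 fun a b c => by simp)
          (ext3 fun a b c => by simp)
    exact congrArg Units.val key
  · have h1 : scal (σ : Form2 k H) * prod = prod * scal (σ : Form2 k H) := hσ.2
    have h2 : scal (pull (flip k H) (σ : Form2 k H)) * prodOp =
        prodOp * scal (pull (flip k H) (σ : Form2 k H)) := by
      have h := congrArg (fun g : WithConv (H ⊗[k] H →ₗ[k] H) => g.ofConv ∘ₗ (flip k H).toLinearMap) h1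
      simp only [LinearMap.convMul_comp_coalgHom_distrib] at h
      exact congrArg toConv h
    have h3 : scal ((σ⁻¹ : (Form2 k H)ˣ) : Form2 k H) * prod =
      prod * scal ((σ⁻¹ : (Form2 k H)ˣ) : Form2 k H) := ((lazyCocycles k H).inv_mem hσ).2
    have h4 := hr.comm
    simp only [twist, Units.val_mul, map_mul, Units.coe_map]
    rw [mul_assoc, h3, ← mul_assoc, mul_assoc (scal (pull (flip k H) (σ : Form2 k H))), h4,
      ← mul_assoc, h2]
    simp only [mul_assoc]

/-- The action `σ · r = (σ ∘ τ) * r * σ⁻¹` of `Z_L(H)` on `𝒰`. -/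
instance : MulAction (lazyCocycles k H) (CoquasiTriangular k H) where
  smul σ r := ⟨twist σ.1 r.1, twist_isCoquasiTriangular σ.2 r.2⟩
  one_smul r := Subtype.ext (by
    change twist 1 r.1 = r.1
    simp [twist])
  mul_smul σ ρ r := Subtype.ext (by
    change twist (σ.1 * ρ.1) r.1 = twist σ.1 (twist ρ.1 r.1)
    simp [twist, mul_assoc])

end Basic

end CQT

/-! ### The Hopf algebra `E(n)` -/

namespace HopfE

/-- The defining relations of `E(n)` in the free algebra on `c` (the generator `none`) and
`x_1, …, x_n` (the generators `some i`). -/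
inductive Rel (k : Type*) [Field k] (n : ℕ) :
    FreeAlgebra k (Option (Fin n)) → FreeAlgebra k (Option (Fin n)) → Prop
  | c_sq : Rel k n (FreeAlgebra.ι k none * FreeAlgebra.ι k none) 1
  | x_sq (i : Fin n) :
      Rel k n (FreeAlgebra.ι k (some i) * FreeAlgebra.ι k (some i)) 0
  | c_x (i : Fin n) :
      Rel k n (FreeAlgebra.ι k none * FreeAlgebra.ι k (some i))
        (-(FreeAlgebra.ι k (some i) * FreeAlgebra.ι k none))
  | x_x (i j : Fin n) (hij : i < j) :
      Rel k n (FreeAlgebra.ι k (some i) * FreeAlgebra.ι k (some j))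
        (-(FreeAlgebra.ι k (some j) * FreeAlgebra.ι k (some i)))

/-- The algebra `E(n)` with generators `c, x_1, …, x_n` and relations `c² = 1`, `x_i² = 0`,
`c x_i = - x_i c`, `x_i x_j = - x_j x_i` for `i < j`. -/
def E (k : Type*) [Field k] (n : ℕ) : Type _ := RingQuot (Rel k n)

variable {k : Type*} [Field k] {n : ℕ}

instance : Ring (E k n) := inferInstanceAs (Ring (RingQuot (Rel k n)))
instance : Algebra k (E k n) := inferInstanceAs (Algebra k (RingQuot (Rel k n)))

/-- The projection from the free algebra. -/
def mk : FreeAlgebra k (Option (Fin n)) →ₐ[k] E k n := RingQuot.mkAlgHom k (Rel k n)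

variable (k n) in
/-- The generator `c`. -/
def c : E k n := mk (FreeAlgebra.ι k none)

variable (k) in
/-- The generators `x_i`. -/
def x (i : Fin n) : E k n := mk (FreeAlgebra.ι k (some i))

theorem mk_rel {a b : FreeAlgebra k (Option (Fin n))} (h : Rel k n a b) : mk a = mk b :=
  RingQuot.mkAlgHom_rel k h

theorem c_mul_c : c k n * c k n = 1 := by
  simpa [c] using mk_rel (k := k) (n := n) Rel.c_sq

theorem x_mul_self (i : Fin n) : x k i * x k i = 0 := by
  simpa [x] using mk_rel (k := k) (Rel.x_sq i)

theorem c_mul_x (i : Fin n) : c k n * x k i = -(x k i * c k n) := by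
  simpa [c, x] using mk_rel (k := k) (Rel.c_x i)

theorem x_mul_x (i j : Fin n) (hij : i < j) : x k i * x k j = -(x k j * x k i) := by
  simpa [x] using mk_rel (k := k) (Rel.x_x i j hij)

section Lift

variable {A : Type*} [Ring A] [Algebra k A]

/-- The universal property of `E(n)`. -/
def lift (c' : A) (x' : Fin n → A) (h1 : c' * c' = 1) (h2 : ∀ i, x' i * x' i = 0)
    (h3 : ∀ i, c' * x' i = -(x' i * c')) (h4 : ∀ i j, i < j → x' i * x' j = -(x' j * x' i)) :
    E k n →ₐ[k] A :=
  RingQuot.liftAlgHom k (s := Rel k n)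
    ⟨FreeAlgebra.lift k fun o => o.elim c' x', by
      intro a b h
      cases h with
      | c_sq => simpa using h1
      | x_sq i => simpa using h2 i
      | c_x i => simpa using h3 i
      | x_x i j hij => simpa using h4 i j hij⟩

variable {c' : A} {x' : Fin n → A} (h1 : c' * c' = 1) (h2 : ∀ i, x' i * x' i = 0)
    (h3 : ∀ i, c' * x' i = -(x' i * c')) (h4 : ∀ i j, i < j → x' i * x' j = -(x' j * x' i))

@[simp] theorem lift_c : lift (k := k) c' x' h1 h2 h3 h4 (c k n) = c' := by
  exact (RingQuot.liftAlgHom_mkAlgHom_apply _ _ _ _).trans (by simp)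

@[simp] theorem lift_x (i : Fin n) : lift (k := k) c' x' h1 h2 h3 h4 (x k i) = x' i := by
  exact (RingQuot.liftAlgHom_mkAlgHom_apply _ _ _ _).trans (by simp)

@[ext] theorem algHom_ext {B : Type*} [Semiring B] [Algebra k B] {f g : E k n →ₐ[k] B}
    (hc : f (c k n) = g (c k n)) (hx : ∀ i, f (x k i) = g (x k i)) : f = g := by
  apply RingQuot.ringQuot_ext'
  ext o
  cases o with
  | none => exact hc
  | some i => exact hx i

end Lift

/-- The coproduct: `Δ(c) = c ⊗ c`, `Δ(x_i) = 1 ⊗ x_i + x_i ⊗ c`. -/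
def comulHom : E k n →ₐ[k] E k n ⊗[k] E k n :=
  lift (c k n ⊗ₜ c k n) (fun i => 1 ⊗ₜ x k i + x k i ⊗ₜ c k n)
    (by simp [c_mul_c, Algebra.TensorProduct.one_def])
    (fun i => by simp [mul_add, add_mul, x_mul_self, c_mul_x, TensorProduct.tmul_neg])
    (fun i => by
      simp [mul_add, add_mul, c_mul_x, c_mul_c, TensorProduct.tmul_neg, TensorProduct.neg_tmul,
        add_comm])
    (fun i j hij => by
      simp only [mul_add, add_mul, Algebra.TensorProduct.tmul_mul_tmul, one_mul, mul_one,
        x_mul_x i j hij, c_mul_x, c_mul_c, TensorProduct.tmul_neg, TensorProduct.neg_tmul]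
      abel)

/-- The counit: `ε(c) = 1`, `ε(x_i) = 0`. -/
def counitHom : E k n →ₐ[k] k :=
  lift 1 (fun _ => 0) (by simp) (by simp) (by simp) (by simp)

@[simp] theorem comulHom_c : comulHom (c k n) = c k n ⊗ₜ[k] c k n := lift_c _ _ _ _
@[simp] theorem comulHom_x (i : Fin n) :
    comulHom (x k i) = 1 ⊗ₜ[k] x k i + x k i ⊗ₜ[k] c k n := lift_x _ _ _ _ i
@[simp] theorem counitHom_c : counitHom (c k n) = 1 := lift_c _ _ _ _
@[simp] theorem counitHom_x (i : Fin n) : counitHom (x k i) = 0 := lift_x _ _ _ _ i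

instance : Bialgebra k (E k n) :=
  Bialgebra.ofAlgHom comulHom counitHom
    (by ext <;> simp [TensorProduct.tmul_add, TensorProduct.add_tmul,
      Algebra.TensorProduct.one_def, add_assoc])
    (by ext <;> simp)
    (by ext <;> simp)

@[simp] theorem comul_c : Coalgebra.comul (R := k) (c k n) = c k n ⊗ₜ[k] c k n := comulHom_c
@[simp] theorem comul_x (i : Fin n) :
    Coalgebra.comul (R := k) (x k i) = 1 ⊗ₜ[k] x k i + x k i ⊗ₜ[k] c k n := comulHom_x i
@[simp] theorem counit_c : Coalgebra.counit (R := k) (c k n) = 1 := counitHom_c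
@[simp] theorem counit_x (i : Fin n) : Coalgebra.counit (R := k) (x k i) = 0 := counitHom_x i

/-- The antipode as an algebra map to the opposite algebra: `S(c) = c`, `S(x_i) = c x_i`. -/
def antipodeHom : E k n →ₐ[k] (E k n)ᵐᵒᵖ :=
  lift (.op (c k n)) (fun i => .op (c k n * x k i))
    (by simp [← MulOpposite.op_mul, c_mul_c])
    (fun i => by
      rw [← MulOpposite.op_mul, mul_assoc, c_mul_x]
      simp [← mul_assoc, x_mul_self])
    (fun i => by
      rw [← MulOpposite.op_mul, ← MulOpposite.op_mul, mul_assoc, ← mul_assoc (c k n) (c k n),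
        ← MulOpposite.op_neg, c_mul_c, one_mul, ← mul_assoc, c_mul_x, neg_mul, mul_assoc, c_mul_c,
        mul_one])
    (fun i j hij => by
      rw [← MulOpposite.op_mul, ← MulOpposite.op_mul, ← MulOpposite.op_neg]
      have h : ∀ a b : Fin n, c k n * x k a * (c k n * x k b) = -(x k a * x k b) := fun a b => by
        rw [c_mul_x a, neg_mul, mul_assoc, ← mul_assoc (c k n), c_mul_c, one_mul]
      rw [h, h, x_mul_x i j hij, neg_neg])

/-- The antipode. -/
def antipode : E k n →ₗ[k] E k n :=
  (MulOpposite.opLinearEquiv k).symm.toLinearMap ∘ₗ antipodeHom.toLinearMap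

theorem antipode_mul (a b : E k n) : antipode (a * b) = antipode b * antipode a := by
  simp [antipode]

@[simp] theorem antipode_one : antipode (1 : E k n) = 1 := by simp [antipode]
@[simp] theorem antipode_c : antipode (c k n) = c k n := by simp [antipode, antipodeHom]
@[simp] theorem antipode_x (i : Fin n) : antipode (x k i) = c k n * x k i := by
  simp [antipode, antipodeHom]

theorem induction {p : E k n → Prop} (h1 : ∀ t : k, p (algebraMap k _ t)) (hc : p (c k n))
    (hx : ∀ i, p (x k i)) (hm : ∀ a b, p a → p b → p (a * b)) (ha : ∀ a b, p a → p b → p (a + b))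
    (a : E k n) : p a := by
  obtain ⟨a, rfl⟩ : ∃ b, mk b = a := RingQuot.mkAlgHom_surjective k (Rel k n) a
  induction a using FreeAlgebra.induction with
  | grade0 r => simpa using h1 r
  | grade1 o =>
    cases o with
    | none => exact hc
    | some i => exact hx i
  | mul a b h h' => simpa using hm _ _ h h'
  | add a b h h' => simpa using ha _ _ h h'

theorem antipode_left (u : E k n ⊗[k] E k n) (p q : E k n) :
    LinearMap.mul' k _ (antipode.rTensor _ (u * p ⊗ₜ q)) =
      antipode p * LinearMap.mul' k _ (antipode.rTensor _ u) * q := by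
  induction u with
  | zero => simp
  | tmul a b => simp [antipode_mul, mul_assoc]
  | add a b h h' => simp only [add_mul, map_add, h, h', mul_add]

theorem antipode_left_mul {u : E k n ⊗[k] E k n} {t : k}
    (h : LinearMap.mul' k _ (antipode.rTensor _ u) = algebraMap k _ t) (v : E k n ⊗[k] E k n) :
    LinearMap.mul' k _ (antipode.rTensor _ (u * v)) =
      algebraMap k _ t * LinearMap.mul' k _ (antipode.rTensor _ v) := by
  induction v with
  | zero => simp
  | tmul p q => rw [antipode_left, h, ← Algebra.commutes, mul_assoc]; simp
  | add a b h h' => simp only [mul_add, map_add, h, h']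

theorem antipode_right (v : E k n ⊗[k] E k n) (p q : E k n) :
    LinearMap.mul' k _ (antipode.lTensor _ (p ⊗ₜ q * v)) =
      p * LinearMap.mul' k _ (antipode.lTensor _ v) * antipode q := by
  induction v with
  | zero => simp
  | tmul a b => simp [antipode_mul, mul_assoc]
  | add a b h h' => simp only [add_mul, map_add, h, h', mul_add]

theorem antipode_right_mul {v : E k n ⊗[k] E k n} {t : k}
    (h : LinearMap.mul' k _ (antipode.lTensor _ v) = algebraMap k _ t) (u : E k n ⊗[k] E k n) :
    LinearMap.mul' k _ (antipode.lTensor _ (u * v)) =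
      LinearMap.mul' k _ (antipode.lTensor _ u) * algebraMap k _ t := by
  induction u with
  | zero => simp
  | tmul p q => rw [antipode_right, h, mul_assoc, Algebra.commutes, ← mul_assoc]; simp
  | add a b h h' => simp only [add_mul, map_add, h, h']

instance : HopfAlgebra k (E k n) where
  antipode := antipode
  mul_antipode_rTensor_comul := by
    ext a
    induction a using induction with
    | h1 t => simp [Algebra.algebraMap_eq_smul_one, Algebra.TensorProduct.one_def]
    | hc => simp [c_mul_c]
    | hx i => simp [mul_assoc, c_mul_x, c_mul_c]
    | ha a b h h' => simpa using congrArg₂ (· + ·) h h'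
    | hm a b h h' =>
      simp only [LinearMap.comp_apply, Algebra.linearMap_apply, Bialgebra.comul_mul,
        Bialgebra.counit_mul, map_mul] at h h' ⊢
      rw [antipode_left_mul h, h']
  mul_antipode_lTensor_comul := by
    ext a
    induction a using induction with
    | h1 t => simp [Algebra.algebraMap_eq_smul_one, Algebra.TensorProduct.one_def]
    | hc => simp [c_mul_c]
    | hx i => simp [c_mul_x]
    | ha a b h h' => simpa using congrArg₂ (· + ·) h h'
    | hm a b h h' =>
      simp only [LinearMap.comp_apply, Algebra.linearMap_apply, Bialgebra.comul_mul,
        Bialgebra.counit_mul, map_mul] at h h' ⊢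
      rw [antipode_right_mul h', h]

/-- The matrix `(r(x_i ⊗ x_j))_{i,j}` that parametrizes a coquasi-triangular structure `r` of
`E(n)`. -/
def matrix (r : CQT.CoquasiTriangular k (E k n)) : Matrix (Fin n) (Fin n) k :=
  Matrix.of fun i j => (r.1 : CQT.Form2 k (E k n)) (x k i ⊗ₜ x k j)

end HopfE

end

/-! Write `H = E(n)`. Currying turns `r` into the map `a ↦ r(a ⊗ -)` from `H` to its convolution
dual. The first identity says that this map is multiplicative, so `r` is determined by the
functionals attached to `c` and the `x_i` (`row`, `pull_m12_eq_iff`). The commutation identity at `c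
⊗ x_j` and `x_i ⊗ c`, together with `2 ≠ 0` and `n ≥ 1`, forces `r(c ⊗ c) = -1` and `r(c ⊗ x_j) =
r(x_i ⊗ c) = 0`. The second identity then makes the functional of `c` the character `sign`, and that
of `x_i` the skew derivation with values `r(x_i ⊗ x_j)`. Hence `matrix_injective`.

Conversely, `sign` and the skew derivations `skew v` satisfy in the dual the defining relations of
`E(n)`, so every matrix yields an algebra map `dualHom` into the dual. Its form is invertible
because composing with the antipode gives the inverse. The two remaining identities are recast
through algebra maps out of `H` or `H ⊗ H`, so in the left argument they need checking only on
generators (`pull_m23_form`, `CommAt.mul`).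

For the orbits, evaluate `(σ · r) * σ = (σ ∘ τ) * r` at `x_i ⊗ x_j`. Laziness and the cocycle
identity give `σ(c ⊗ c) = σ(1 ⊗ 1) ≠ 0` and `σ(c ⊗ x_j) = 0`, so the action subtracts from `A_r` a
symmetric matrix, a multiple of `(σ(x_i ⊗ x_j) + σ(x_j ⊗ x_i))` (`twist_x_x`), and the skew part is
invariant. Every symmetric matrix occurs: `p⁻¹ * q` is a lazy cocycle for any two coquasi-triangular
structures (`inv_mul_mem_lazyCocycles`), and with `A_p = 0` its values on the `x_i ⊗ x_j` are the
entries of `A_q`, which can be prescribed. -/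

noncomputable section

/-! ### Quotients of coquasi-triangular structures -/

namespace CQT

variable {k H : Type*} [CommRing k] [Ring H] [Bialgebra k H]

/-- The quotient of two coquasi-triangular structures is a lazy cocycle. -/
theorem inv_mul_mem_lazyCocycles {r s : (Form2 k H)ˣ} (hr : IsCoquasiTriangular (r : Form2 k H))
    (hs : IsCoquasiTriangular (s : Form2 k H)) : s⁻¹ * r ∈ lazyCocycles k H := by
  -- A coquasi-triangular structure is itself a left 2-cocycle: both sides equal `t₂₃ * t₁₃ * t₁₂`.
  have cocycle : ∀ {t : (Form2 k H)ˣ}, IsCoquasiTriangular (t : Form2 k H) →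
      upull (p12 k H) t * upull (m12 k H) t = upull (p23 k H) t * upull (m23 k H) t := by
    intro t ht
    have e1 : upull (m23 k H) t = upull (p13 k H) t * upull (p12 k H) t := Units.ext ht.mul_right
    have e2 : upull ((m12 k H).comp (swp k H)) t = upull (p23 k H) t * upull (p13 k H) t := by
      have h := congrArg (pull (swp k H)) ht.mul_left
      rw [map_mul] at h
      have e : (p13 k H).comp (swp k H) = p23 k H := ext3 fun a b c => by simp
      rw [← e]
      exact Units.ext h
    have e3 : upull (p12 k H) t * upull (m12 k H) t =
        upull ((m12 k H).comp (swp k H)) t * upull (p12 k H) t :=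
      swap_pull ht t (CoalgHom.id k _) rfl rfl rfl
    rw [e3, e1]
    exact (congrArg (· * _) e2).trans (mul_assoc _ _ _)
  have swap12 : ∀ {t : (Form2 k H)ˣ}, IsCoquasiTriangular (t : Form2 k H) → ∀ f : (Form2 k H)ˣ,
      upull (p12 k H) t * upull (m12 k H) f =
        upull ((m12 k H).comp (swp k H)) f * upull (p12 k H) t := fun ht f =>
    swap_pull ht f (CoalgHom.id k _) rfl rfl rfl
  have swap23 : ∀ {t : (Form2 k H)ˣ}, IsCoquasiTriangular (t : Form2 k H) → ∀ f : (Form2 k H)ˣ,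
      upull (p23 k H) t * upull (m23 k H) f =
        upull ((flip k H).comp (((m12 k H).comp (swp k H)).comp (rot k H))) f *
          upull (p23 k H) t := fun ht f =>
    swap_pull_flip ht f (rot k H) rfl (ext3 fun a b c => by simp) rfl
  refine ⟨?_, ?_⟩
  -- Moving `r₁₂` past `s⁻¹ ∘ m₁₂` reverses the product inside `s⁻¹`; `s₁₂` reverses it back. The
  -- left side thus becomes the inverse of the cocycle expression of `s` times that of `r`, and the
  -- right side is reached symmetrically.
  · have key : upull (p12 k H) (s⁻¹ * r) * upull (m12 k H) (s⁻¹ * r) =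
        upull (p23 k H) (s⁻¹ * r) * upull (m23 k H) (s⁻¹ * r) := by
      have h1 := swap12 hr s⁻¹
      have h2 := swap12 hs s
      have h3 := swap23 hr s⁻¹
      have h4 := swap23 hs s
      have h5 := cocycle hr
      have h6 := cocycle hs
      calc upull (p12 k H) (s⁻¹ * r) * upull (m12 k H) (s⁻¹ * r)
          = (upull (p12 k H) s)⁻¹ * (upull (p12 k H) r * upull (m12 k H) s⁻¹) *
              upull (m12 k H) r := by simp only [map_mul, map_inv, mul_assoc]
        _ = (upull (p12 k H) s * upull (m12 k H) s)⁻¹ *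
              (upull (p12 k H) r * upull (m12 k H) r) := by
            rw [h1, h2]; simp only [map_inv]; group
        _ = (upull (p23 k H) s)⁻¹ * (upull (p23 k H) r * upull (m23 k H) s⁻¹) *
              upull (m23 k H) r := by
            rw [h5, h6, h3, h4]; simp only [map_inv]; group
        _ = _ := by simp only [map_mul, map_inv, mul_assoc]
    exact congrArg Units.val key
  · have h1 := hr.comm
    -- `r` turns the product into its opposite and `s⁻¹` turns it back, so `s⁻¹ * r` commutes with
    -- the product.
    have h2 : scal ((s⁻¹ : (Form2 k H)ˣ) : Form2 k H) * prodOp =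
        prod * scal ((s⁻¹ : (Form2 k H)ˣ) : Form2 k H) := by
      have e1 : scal ((s⁻¹ : (Form2 k H)ˣ) : Form2 k H) * scal (s : Form2 k H) = 1 := by
        rw [← map_mul, Units.inv_mul, map_one]
      have e2 : scal (s : Form2 k H) * scal ((s⁻¹ : (Form2 k H)ˣ) : Form2 k H) = 1 := by
        rw [← map_mul, Units.mul_inv, map_one]
      calc scal ((s⁻¹ : (Form2 k H)ˣ) : Form2 k H) * prodOp
          = scal ((s⁻¹ : (Form2 k H)ˣ) : Form2 k H) *
              (prodOp * scal (s : Form2 k H)) * scal ((s⁻¹ : (Form2 k H)ˣ) : Form2 k H) := by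
            rw [mul_assoc, mul_assoc, e2, mul_one]
        _ = _ := by rw [← hs.comm, ← mul_assoc, e1, one_mul]
    change scal ((s⁻¹ * r : (Form2 k H)ˣ) : Form2 k H) * prod = prod * scal _
    rw [Units.val_mul, map_mul, mul_assoc, h1, ← mul_assoc, h2, mul_assoc]

/-! ### Convolution products in Sweedler notation -/

theorem sum_counit_smul_right {C ι : Type*} [AddCommGroup C] [Module k C] [Coalgebra k C] {c : C}
    (R : Coalgebra.Repr k c ι) :
    ∑ j ∈ R.index, Coalgebra.counit (R := k) (R.right j) • R.left j = c := by
  have h := congrArg (TensorProduct.rid k C) (Coalgebra.sum_tmul_counit_eq R)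
  simpa only [map_sum, TensorProduct.rid_tmul, one_smul] using h

/-- `b ↦ r(a ⊗ b)`. -/
def row (r : Form2 k H) (a : H) : WithConv (H →ₗ[k] k) :=
  toConv (r.ofConv ∘ₗ TensorProduct.mk k H H a)

theorem row_apply (r : Form2 k H) (a b : H) : row r a b = r (a ⊗ₜ b) := rfl

theorem sum_counit_mul_left {C ι : Type*} [AddCommGroup C] [Module k C] [Coalgebra k C] {c : C}
    (R : Coalgebra.Repr k c ι) (f : C →ₗ[k] k) :
    ∑ j ∈ R.index, Coalgebra.counit (R := k) (R.left j) * f (R.right j) = f c := by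
  conv_rhs => rw [← Coalgebra.sum_counit_smul R]
  simp

theorem sum_counit_mul_right {C ι : Type*} [AddCommGroup C] [Module k C] [Coalgebra k C] {c : C}
    (R : Coalgebra.Repr k c ι) (f : C →ₗ[k] k) :
    ∑ j ∈ R.index, Coalgebra.counit (R := k) (R.right j) * f (R.left j) = f c := by
  conv_rhs => rw [← sum_counit_smul_right R]
  simp

/-- `a ↦ r(a ⊗ b)`. -/
def col (r : Form2 k H) (b : H) : WithConv (H →ₗ[k] k) :=
  toConv (r.ofConv ∘ₗ (TensorProduct.mk k H H).flip b)

theorem col_apply (r : Form2 k H) (a b : H) : col r b a = r (a ⊗ₜ b) := rfl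

/-- The projections apply the counit to one half of `Δ(a)` and of `Δ(b)`, so only the coproduct of
`d` survives. -/
theorem pull_p13_mul_pull_p23 (f g : Form2 k H) (a b d : H) :
    (pull (p13 k H) f * pull (p23 k H) g) ((a ⊗ₜ b) ⊗ₜ d) = (row f a * row g b) d := by
  rw [(((Coalgebra.Repr.arbitrary k a).tmul (Coalgebra.Repr.arbitrary k b)).tmul
    (Coalgebra.Repr.arbitrary k d)).convMul_apply, (Coalgebra.Repr.arbitrary k d).convMul_apply]
  simp only [Coalgebra.Repr.tmul_index, Coalgebra.Repr.tmul_left, Coalgebra.Repr.tmul_right,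
    Finset.sum_product_right, pull_apply, p13_tmul, p23_tmul, map_smul, smul_eq_mul]
  refine Finset.sum_congr rfl fun l _ => ?_
  rw [row_apply, row_apply, ← col_apply, ← col_apply]
  rw [← sum_counit_mul_right (Coalgebra.Repr.arbitrary k a) (col f _).ofConv,
      ← sum_counit_mul_left (Coalgebra.Repr.arbitrary k b) (col g _).ofConv, Finset.sum_mul_sum,
      Finset.sum_comm]
  refine Finset.sum_congr rfl fun i _ => Finset.sum_congr rfl fun j _ => ?_
  change _ = _ * f (_ ⊗ₜ _) * (_ * g (_ ⊗ₜ _))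
  ring

theorem pull_p13_mul_pull_p12 (f g : Form2 k H) (a b d : H) :
    (pull (p13 k H) f * pull (p12 k H) g) ((a ⊗ₜ b) ⊗ₜ d) = (col f d * col g b) a := by
  rw [(((Coalgebra.Repr.arbitrary k a).tmul (Coalgebra.Repr.arbitrary k b)).tmul
    (Coalgebra.Repr.arbitrary k d)).convMul_apply, (Coalgebra.Repr.arbitrary k a).convMul_apply]
  simp only [Coalgebra.Repr.tmul_index, Coalgebra.Repr.tmul_left, Coalgebra.Repr.tmul_right,
    Finset.sum_product, pull_apply, p13_tmul, p12_tmul, map_smul, smul_eq_mul]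
  refine Finset.sum_congr rfl fun l _ => ?_
  rw [col_apply, col_apply, ← row_apply, ← row_apply]
  rw [← sum_counit_mul_right (Coalgebra.Repr.arbitrary k d) (row f _).ofConv,
      ← sum_counit_mul_left (Coalgebra.Repr.arbitrary k b) (row g _).ofConv, Finset.sum_mul_sum,
      Finset.sum_comm]
  refine Finset.sum_congr rfl fun i _ => Finset.sum_congr rfl fun j _ => ?_
  change _ = _ * f (_ ⊗ₜ _) * (_ * g (_ ⊗ₜ _))
  ring

theorem pull_m12_eq_iff {r : Form2 k H} :
    pull (m12 k H) r = pull (p13 k H) r * pull (p23 k H) r ↔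
      ∀ a b : H, row r (a * b) = row r a * row r b := by
  refine ⟨fun h a b => ?_, fun h => ?_⟩
  · ext d
    exact (congrArg (fun f : WithConv ((H ⊗[k] H) ⊗[k] H →ₗ[k] k) => f ((a ⊗ₜ b) ⊗ₜ d)) h).trans
      (pull_p13_mul_pull_p23 r r a b d)
  · apply WithConv.ext
    refine TensorProduct.ext_threefold fun a b d => ?_
    exact (congrArg (fun f : WithConv (H →ₗ[k] k) => f d) (h a b)).trans
      (pull_p13_mul_pull_p23 r r a b d).symm

theorem pull_m23_eq_iff {r : Form2 k H} :
    pull (m23 k H) r = pull (p13 k H) r * pull (p12 k H) r ↔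
      ∀ b d : H, col r (b * d) = col r d * col r b := by
  refine ⟨fun h b d => ?_, fun h => ?_⟩
  · ext a
    exact (congrArg (fun f : WithConv ((H ⊗[k] H) ⊗[k] H →ₗ[k] k) => f ((a ⊗ₜ b) ⊗ₜ d)) h).trans
      (pull_p13_mul_pull_p12 r r a b d)
  · apply WithConv.ext
    refine TensorProduct.ext_threefold fun a b d => ?_
    exact (congrArg (fun f : WithConv (H →ₗ[k] k) => f a) (h b d)).trans
      (pull_p13_mul_pull_p12 r r a b d).symm

/-- Since `Δ(a) = a ⊗ a`, only `b` is split by the coproduct of `a ⊗ b`. The case `a = 1` makes `row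
r 1` invertible. -/
theorem row_mul_of_comul (f g : Form2 k H) {a : H} (ha : Coalgebra.comul (R := k) a = a ⊗ₜ a) :
    row (f * g) a = row f a * row g a := by
  ext b
  change (f * g) (a ⊗ₜ b) = _
  rw [LinearMap.convMul_apply, LinearMap.convMul_apply, TensorProduct.comul_tmul, ha]
  induction Coalgebra.comul (R := k) b with
  | zero => simp
  | tmul x y => simp [row]
  | add x y hx hy => simp only [TensorProduct.tmul_add, map_add, hx, hy]

theorem col_mul_of_comul (f g : Form2 k H) {b : H} (hb : Coalgebra.comul (R := k) b = b ⊗ₜ b) :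
    col (f * g) b = col f b * col g b := by
  ext a
  change (f * g) (a ⊗ₜ b) = _
  rw [LinearMap.convMul_apply, LinearMap.convMul_apply, TensorProduct.comul_tmul, hb]
  induction Coalgebra.comul (R := k) a with
  | zero => simp
  | tmul x y => simp [col]
  | add x y hx hy => simp only [TensorProduct.add_tmul, map_add, hx, hy]

theorem row_unit (r : (Form2 k H)ˣ) : IsUnit (row (r : Form2 k H) 1) := by
  have h1 : row (1 : Form2 k H) 1 = 1 := by ext; simp [row, LinearMap.convOne_def]
  have hc : Coalgebra.comul (R := k) (1 : H) = 1 ⊗ₜ 1 := Bialgebra.comul_one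
  exact ⟨⟨row (r : Form2 k H) 1, row ((r⁻¹ : (Form2 k H)ˣ) : Form2 k H) 1,
    by rw [← row_mul_of_comul _ _ hc, Units.mul_inv, h1],
    by rw [← row_mul_of_comul _ _ hc, Units.inv_mul, h1]⟩, rfl⟩

theorem col_unit (r : (Form2 k H)ˣ) : IsUnit (col (r : Form2 k H) 1) := by
  have h1 : col (1 : Form2 k H) 1 = 1 := by ext; simp [col, LinearMap.convOne_def]
  have hc : Coalgebra.comul (R := k) (1 : H) = 1 ⊗ₜ 1 := Bialgebra.comul_one
  exact ⟨⟨col (r : Form2 k H) 1, col ((r⁻¹ : (Form2 k H)ˣ) : Form2 k H) 1,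
    by rw [← col_mul_of_comul _ _ hc, Units.mul_inv, h1],
    by rw [← col_mul_of_comul _ _ hc, Units.inv_mul, h1]⟩, rfl⟩

/-- An invertible idempotent is the identity. -/
theorem row_one {r : (Form2 k H)ˣ} (hr : IsCoquasiTriangular (r : Form2 k H)) :
    row (r : Form2 k H) 1 = 1 := by
  have h := pull_m12_eq_iff.1 hr.mul_left 1 1
  rw [mul_one] at h
  exact (row_unit r).mul_left_cancel (h.symm.trans (mul_one _).symm)

theorem col_one {r : (Form2 k H)ˣ} (hr : IsCoquasiTriangular (r : Form2 k H)) :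
    col (r : Form2 k H) 1 = 1 := by
  have h := pull_m23_eq_iff.1 hr.mul_right 1 1
  rw [mul_one] at h
  exact (col_unit r).mul_left_cancel (h.symm.trans (mul_one _).symm)

/-! ### Currying, and convolution inverses from the antipode -/

/-- The form `a ⊗ b ↦ f(a)(b)`. -/
def form (f : H →ₗ[k] WithConv (H →ₗ[k] k)) : Form2 k H :=
  toConv (TensorProduct.lift ((WithConv.linearEquiv k (H →ₗ[k] k)).toLinearMap ∘ₗ f))

@[simp] theorem form_apply (f : H →ₗ[k] WithConv (H →ₗ[k] k)) (a b : H) :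
    form f (a ⊗ₜ b) = f a b := rfl

/-- Uncurrying respects convolution, so inverses may be sought among maps from `H` to its dual. -/
theorem form_mul (f g : H →ₗ[k] WithConv (H →ₗ[k] k)) :
    form f * form g = form (toConv f * toConv g).ofConv := by
  apply WithConv.ext
  refine TensorProduct.ext' fun a b => ?_
  change (form f * form g) (a ⊗ₜ b) = (toConv f * toConv g) a b
  rw [LinearMap.convMul_apply, LinearMap.convMul_apply, TensorProduct.comul_tmul]
  induction Coalgebra.comul (R := k) a with
  | zero => simp
  | tmul x y =>
    simp only [LinearMap.mul'_apply, TensorProduct.map_tmul]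
    rw [LinearMap.convMul_apply]
    induction Coalgebra.comul (R := k) b with
    | zero => simp
    | tmul z w => simp [form]
    | add u v hu hv => simp only [TensorProduct.tmul_add, map_add, hu, hv]
  | add u v hu hv =>
    simp only [TensorProduct.add_tmul, map_add, hu, hv]
    rfl

theorem form_one : form (1 : WithConv (H →ₗ[k] WithConv (H →ₗ[k] k))).ofConv = 1 := by
  apply WithConv.ext
  refine TensorProduct.ext' fun a b => ?_
  simp only [LinearMap.convOne_def]
  change Coalgebra.counit (R := k) a • Coalgebra.counit (R := k) b = _
  simp [mul_comm]

end CQT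

namespace CQT

variable {k H : Type*} [CommRing k] [Ring H] [HopfAlgebra k H]

/-- An algebra map `H → H^*` gives a convolution invertible form on `H ⊗ H`. -/
def unitForm (φ : H →ₐ[k] WithConv (H →ₗ[k] k)) : (Form2 k H)ˣ where
  val := form φ.toLinearMap
  inv := form (φ.toLinearMap ∘ₗ HopfAlgebra.antipode k)
  val_inv := by
    rw [form_mul, ← form_one]
    have h := LinearMap.algHom_comp_convMul_distrib φ (toConv LinearMap.id)
      (toConv (HopfAlgebra.antipode k (A := H)))
    rw [LinearMap.id_mul_antipode] at h
    refine congrArg form (h.symm.trans ?_)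
    ext a
    simp [LinearMap.convOne_def]
  inv_val := by
    rw [form_mul, ← form_one]
    have h := LinearMap.algHom_comp_convMul_distrib φ
      (toConv (HopfAlgebra.antipode k (A := H))) (toConv LinearMap.id)
    rw [LinearMap.antipode_mul_id] at h
    refine congrArg form (h.symm.trans ?_)
    ext a
    simp [LinearMap.convOne_def]

end CQT

namespace CQT

variable {k H : Type*} [CommRing k] [Ring H] [Bialgebra k H]

/-! ### Coquasi-triangular structures from algebra maps to the dual -/

/-- Precomposition with a coalgebra map, as an algebra map. -/
def pullAlg {C D : Type*} [AddCommGroup C] [Module k C] [Coalgebra k C]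
    [AddCommGroup D] [Module k D] [Coalgebra k D] (φ : C →ₗc[k] D) :
    WithConv (D →ₗ[k] k) →ₐ[k] WithConv (C →ₗ[k] k) :=
  AlgHom.ofLinearMap
    { toFun := pull φ, map_add' := fun _ _ => rfl, map_smul' := fun _ _ => rfl }
    (map_one (pull φ)) (map_mul (pull φ))

variable (k H) in
/-- `a ⊗ b ↦ ε(b) a`. -/
def q1 : H ⊗[k] H →ₗc[k] H :=
  (Coalgebra.TensorProduct.rid k k H : _ →ₗc[k] _).comp
    (Coalgebra.TensorProduct.map (CoalgHom.id k H) (Coalgebra.counitCoalgHom k H))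

variable (k H) in
/-- `a ⊗ b ↦ ε(a) b`. -/
def q2 : H ⊗[k] H →ₗc[k] H := (q1 k H).comp (flip k H)

@[simp] theorem q1_tmul (a b : H) : q1 k H (a ⊗ₜ b) = Coalgebra.counit (R := k) b • a := rfl
@[simp] theorem q2_tmul (a b : H) : q2 k H (a ⊗ₜ b) = Coalgebra.counit (R := k) a • b := rfl

theorem pull_q1_mul_pull_q2 (f g : WithConv (H →ₗ[k] k)) (a b : H) :
    (pull (q1 k H) f * pull (q2 k H) g) (a ⊗ₜ b) = f a * g b := by
  rw [((Coalgebra.Repr.arbitrary k a).tmul (Coalgebra.Repr.arbitrary k b)).convMul_apply,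
    ← sum_counit_mul_right (Coalgebra.Repr.arbitrary k a) f.ofConv,
    ← sum_counit_mul_left (Coalgebra.Repr.arbitrary k b) g.ofConv, Finset.sum_mul_sum]
  simp only [Coalgebra.Repr.tmul_index, Coalgebra.Repr.tmul_left, Coalgebra.Repr.tmul_right,
    Finset.sum_product, pull_apply, q1_tmul, q2_tmul, map_smul, smul_eq_mul]
  refine Finset.sum_congr rfl fun i _ => Finset.sum_congr rfl fun j _ => ?_
  ring

theorem pull_q2_mul_pull_q1 (f g : WithConv (H →ₗ[k] k)) (a b : H) :
    (pull (q2 k H) g * pull (q1 k H) f) (a ⊗ₜ b) = f a * g b := by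
  rw [((Coalgebra.Repr.arbitrary k a).tmul (Coalgebra.Repr.arbitrary k b)).convMul_apply,
    ← sum_counit_mul_left (Coalgebra.Repr.arbitrary k a) f.ofConv,
    ← sum_counit_mul_right (Coalgebra.Repr.arbitrary k b) g.ofConv, Finset.sum_mul_sum]
  simp only [Coalgebra.Repr.tmul_index, Coalgebra.Repr.tmul_left, Coalgebra.Repr.tmul_right,
    Finset.sum_product, pull_apply, q1_tmul, q2_tmul, map_smul, smul_eq_mul]
  refine Finset.sum_congr rfl fun i _ => Finset.sum_congr rfl fun j _ => ?_
  ring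

/-- In either order the product is the external product `a ⊗ b ↦ f(a) g(b)`. This commutation is
what lets `dualMul` be defined on the tensor product. -/
theorem pull_q_commute (f g : WithConv (H →ₗ[k] k)) :
    Commute (pullAlg (q2 k H) g) (pullAlg (q1 k H) f) := by
  apply WithConv.ext
  refine TensorProduct.ext' fun a b => ?_
  exact (pull_q2_mul_pull_q1 f g a b).trans (pull_q1_mul_pull_q2 f g a b).symm

/-- Multiplicativity of `Δ` carries product rules through convolution. The two-term shape covers
skew derivations, and characters by taking the second term zero. -/
theorem convMul_mul {f f₁ f₂ f₃ f₄ g g₁ g₂ g₃ g₄ : WithConv (H →ₗ[k] k)}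
    (hf : ∀ b d, f (b * d) = f₁ b * f₂ d + f₃ b * f₄ d)
    (hg : ∀ b d, g (b * d) = g₁ b * g₂ d + g₃ b * g₄ d) (b d : H) :
    (f * g) (b * d) = (f₁ * g₁) b * (f₂ * g₂) d + (f₁ * g₃) b * (f₂ * g₄) d +
      (f₃ * g₁) b * (f₄ * g₂) d + (f₃ * g₃) b * (f₄ * g₄) d := by
  simp only [LinearMap.convMul_apply, Bialgebra.comul_mul]
  induction Coalgebra.comul (R := k) b with
  | zero => simp
  | tmul x y =>
    induction Coalgebra.comul (R := k) d with
    | zero => simp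
    | tmul z w =>
      simp only [Algebra.TensorProduct.tmul_mul_tmul, TensorProduct.map_tmul, LinearMap.mul'_apply,
        hf, hg]
      ring
    | add u v hu hv => simp only [mul_add, map_add, hu, hv]; abel
  | add u v hu hv => simp only [add_mul, map_add, hu, hv]; abel

variable (φ : H →ₐ[k] WithConv (H →ₗ[k] k))

/-- The algebra map `u ⊗ v ↦ (b ⊗ d ↦ φ(u)(d) φ(v)(b))`. -/
def dualMul : H ⊗[k] H →ₐ[k] WithConv (H ⊗[k] H →ₗ[k] k) :=
  Algebra.TensorProduct.lift ((pullAlg (q2 k H)).comp φ) ((pullAlg (q1 k H)).comp φ)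
    fun _ _ => pull_q_commute _ _

theorem dualMul_tmul (u v b d : H) : dualMul φ (u ⊗ₜ v) (b ⊗ₜ d) = φ v b * φ u d := by
  exact (congrArg (fun f : WithConv (H ⊗[k] H →ₗ[k] k) => f (b ⊗ₜ d))
    (Algebra.TensorProduct.lift_tmul _ _ _ u v)).trans (pull_q2_mul_pull_q1 _ _ _ _)

theorem pull_m12_form :
    pull (m12 k H) (form φ.toLinearMap) =
      pull (p13 k H) (form φ.toLinearMap) * pull (p23 k H) (form φ.toLinearMap) :=
  pull_m12_eq_iff.2 fun a b => map_mul φ a b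

/-- The hypothesis is an equality of two algebra maps out of `H`, hence can be checked on
generators; this is the point of phrasing the second identity this way. -/
theorem pull_m23_form
    (h : (pullAlg (Bialgebra.mulCoalgHom k H)).comp φ =
      (dualMul φ).comp (Bialgebra.comulAlgHom k H)) :
    pull (m23 k H) (form φ.toLinearMap) =
      pull (p13 k H) (form φ.toLinearMap) * pull (p12 k H) (form φ.toLinearMap) := by
  refine pull_m23_eq_iff.2 fun b d => ?_
  ext a
  have h1 : φ a (b * d) = dualMul φ (Coalgebra.comul (R := k) a) (b ⊗ₜ d) :=
    congrArg (fun f : WithConv (H ⊗[k] H →ₗ[k] k) => f (b ⊗ₜ d)) (DFunLike.congr_fun h a)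
  refine h1.trans ?_
  rw [LinearMap.convMul_apply]
  induction Coalgebra.comul (R := k) a with
  | zero => simp
  | tmul x y => rw [dualMul_tmul, mul_comm]; rfl
  | add x y hx hy =>
    simp only [map_add, ← hx, ← hy]
    rfl

/-! ### The commutation identity as an identity of algebra maps -/

variable (k) in
/-- The map `b ↦ ε(b) a`. -/
def cst : H →ₐ[k] WithConv (H →ₗ[k] H) :=
  AlgHom.ofLinearMap
    { toFun := fun a => toConv ((Coalgebra.counit (R := k) (A := H)).smulRight a)
      map_add' := fun a b => by ext; simp
      map_smul' := fun t a => by ext; simp [smul_comm t] }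
    (by ext; simp [Algebra.algebraMap_eq_smul_one])
    (fun a b => by
      ext d
      conv_lhs => rw [← Coalgebra.sum_counit_smul (Coalgebra.Repr.arbitrary k d)]
      rw [(Coalgebra.Repr.arbitrary k d).convMul_apply]
      simp [smul_smul, mul_comm])

theorem cst_mul (a : H) (f : WithConv (H →ₗ[k] H)) (b : H) : (cst k a * f) b = a * f b := by
  rw [(Coalgebra.Repr.arbitrary k b).convMul_apply]
  conv_rhs => rw [← Coalgebra.sum_counit_smul (Coalgebra.Repr.arbitrary k b)]
  simp [cst, Finset.mul_sum]

theorem mul_cst (a : H) (f : WithConv (H →ₗ[k] H)) (b : H) : (f * cst k a) b = f b * a := by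
  rw [(Coalgebra.Repr.arbitrary k b).convMul_apply]
  conv_rhs => rw [← sum_counit_smul_right (Coalgebra.Repr.arbitrary k b)]
  simp [cst, Finset.sum_mul]

variable (k H) in
/-- A linear form on `H` seen with values in `k 1 ⊆ H`. -/
def scalOne : WithConv (H →ₗ[k] k) →ₐ[k] WithConv (H →ₗ[k] H) :=
  AlgHom.ofLinearMap
    { toFun := fun f => toConv (Algebra.linearMap k H ∘ₗ f.ofConv)
      map_add' := fun a b => by ext; simp
      map_smul' := fun t a => by
        ext b
        exact (map_mul (algebraMap k H) t (a b)).trans (Algebra.smul_def _ _).symm }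
    (by ext; simp [LinearMap.convOne_def])
    (fun f g => congrArg toConv
      (LinearMap.algHom_comp_convMul_distrib (Algebra.ofId k H) f g))

theorem scalOne_apply (f : WithConv (H →ₗ[k] k)) (b : H) :
    scalOne k H f b = algebraMap k H (f b) := rfl

theorem scalOne_commute_cst (f : WithConv (H →ₗ[k] k)) (a : H) :
    Commute (scalOne k H f) (cst k a) := by
  ext b
  exact (mul_cst a (scalOne k H f) b).trans ((Algebra.commutes _ _).trans (cst_mul a (scalOne k H f) b).symm)

/-- The analogue of `convMul_mul` for `b ↦ ∑ f(b₁) b₂`; it uses that scalars are central in `H`. -/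
theorem scalOne_convMul_id_mul {f f₁ f₂ f₃ f₄ : WithConv (H →ₗ[k] k)}
    (hf : ∀ b d, f (b * d) = f₁ b * f₂ d + f₃ b * f₄ d) (b d : H) :
    (scalOne k H f * toConv LinearMap.id : WithConv (H →ₗ[k] H)) (b * d) =
      (scalOne k H f₁ * toConv LinearMap.id : WithConv (H →ₗ[k] H)) b *
          (scalOne k H f₂ * toConv LinearMap.id : WithConv (H →ₗ[k] H)) d +
        (scalOne k H f₃ * toConv LinearMap.id : WithConv (H →ₗ[k] H)) b *
          (scalOne k H f₄ * toConv LinearMap.id : WithConv (H →ₗ[k] H)) d := by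
  simp only [LinearMap.convMul_apply, Bialgebra.comul_mul]
  induction Coalgebra.comul (R := k) b with
  | zero => simp
  | tmul x y =>
    induction Coalgebra.comul (R := k) d with
    | zero => simp
    | tmul z w =>
      simp only [Algebra.TensorProduct.tmul_mul_tmul, TensorProduct.map_tmul, LinearMap.mul'_apply,
        scalOne_apply, hf, LinearMap.id_apply, ← Algebra.smul_def, smul_mul_assoc,
        mul_smul_comm, add_smul, mul_smul, smul_comm (f₂ z), smul_comm (f₄ z)]
    | add u v hu hv => simp only [mul_add, map_add, hu, hv]; abel
  | add u v hu hv => simp only [add_mul, map_add, hu, hv]; abel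

theorem id_convMul_scalOne_mul {f f₁ f₂ f₃ f₄ : WithConv (H →ₗ[k] k)}
    (hf : ∀ b d, f (b * d) = f₁ b * f₂ d + f₃ b * f₄ d) (b d : H) :
    (toConv LinearMap.id * scalOne k H f : WithConv (H →ₗ[k] H)) (b * d) =
      (toConv LinearMap.id * scalOne k H f₁ : WithConv (H →ₗ[k] H)) b *
          (toConv LinearMap.id * scalOne k H f₂ : WithConv (H →ₗ[k] H)) d +
        (toConv LinearMap.id * scalOne k H f₃ : WithConv (H →ₗ[k] H)) b *
          (toConv LinearMap.id * scalOne k H f₄ : WithConv (H →ₗ[k] H)) d := by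
  simp only [LinearMap.convMul_apply, Bialgebra.comul_mul]
  induction Coalgebra.comul (R := k) b with
  | zero => simp
  | tmul x y =>
    induction Coalgebra.comul (R := k) d with
    | zero => simp
    | tmul z w =>
      simp only [Algebra.TensorProduct.tmul_mul_tmul, TensorProduct.map_tmul, LinearMap.mul'_apply,
        scalOne_apply, hf, LinearMap.id_apply, ← Algebra.commutes,
        ← Algebra.smul_def, smul_mul_assoc, mul_smul_comm, add_smul, mul_smul,
        smul_comm (f₂ w), smul_comm (f₄ w)]
    | add u v hu hv => simp only [mul_add, map_add, hu, hv]; abel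
  | add u v hu hv => simp only [add_mul, map_add, hu, hv]; abel

/-- The algebra map `u ⊗ v ↦ (b ↦ φ(u)(b) v)`. -/
def leftPairing : H ⊗[k] H →ₐ[k] WithConv (H →ₗ[k] H) :=
  Algebra.TensorProduct.lift ((scalOne k H).comp φ) (cst k) fun _ _ => scalOne_commute_cst _ _

/-- The algebra map `u ⊗ v ↦ (b ↦ φ(v)(b) u)`. -/
def rightPairing : H ⊗[k] H →ₐ[k] WithConv (H →ₗ[k] H) :=
  Algebra.TensorProduct.lift (cst k) ((scalOne k H).comp φ) fun _ _ => (scalOne_commute_cst _ _).symm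

theorem leftPairing_tmul (u v : H) :
    leftPairing φ (u ⊗ₜ v) = scalOne k H (φ u) * cst k v :=
  Algebra.TensorProduct.lift_tmul _ _ _ u v

theorem rightPairing_tmul (u v : H) :
    rightPairing φ (u ⊗ₜ v) = cst k u * scalOne k H (φ v) :=
  Algebra.TensorProduct.lift_tmul _ _ _ u v

theorem scal_form_mul_prod (a b : H) :
    (scal (form φ.toLinearMap) * prod : WithConv (H ⊗[k] H →ₗ[k] H)) (a ⊗ₜ b) =
      (leftPairing φ (Coalgebra.comul (R := k) a) * toConv LinearMap.id : WithConv (H →ₗ[k] H)) b := by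
  rw [LinearMap.convMul_apply, TensorProduct.comul_tmul]
  induction Coalgebra.comul (R := k) a with
  | zero => simp
  | tmul x y =>
    rw [leftPairing_tmul, mul_assoc, LinearMap.convMul_apply]
    induction Coalgebra.comul (R := k) b with
    | zero => simp
    | tmul z w =>
      simpa [scalOne_apply, scal_apply, prod] using
        congrArg _ (cst_mul y (toConv LinearMap.id) w).symm
    | add u v hu hv => simp only [TensorProduct.tmul_add, map_add, hu, hv]
  | add u v hu hv =>
    simp only [TensorProduct.add_tmul, map_add, hu, hv, add_mul]
    rfl

theorem prodOp_mul_scal_form (a b : H) :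
    (prodOp * scal (form φ.toLinearMap) : WithConv (H ⊗[k] H →ₗ[k] H)) (a ⊗ₜ b) =
      (toConv LinearMap.id * rightPairing φ (Coalgebra.comul (R := k) a) : WithConv (H →ₗ[k] H)) b := by
  rw [LinearMap.convMul_apply, TensorProduct.comul_tmul]
  induction Coalgebra.comul (R := k) a with
  | zero => simp
  | tmul x y =>
    rw [rightPairing_tmul, ← mul_assoc, LinearMap.convMul_apply]
    induction Coalgebra.comul (R := k) b with
    | zero => simp
    | tmul z w =>
      simpa [scalOne_apply, scal_apply, prodOp] using
        congrArg (· * algebraMap k H (φ y w)) (mul_cst x (toConv LinearMap.id) z).symm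
    | add u v hu hv => simp only [TensorProduct.tmul_add, map_add, hu, hv]
  | add u v hu hv =>
    simp only [TensorProduct.add_tmul, map_add, hu, hv, mul_add]
    rfl

/-- The commutation identity of a coquasi-triangular structure for a fixed left argument `a`. -/
def CommAt (a : H) : Prop :=
  leftPairing φ (Coalgebra.comul (R := k) a) * toConv LinearMap.id =
    toConv LinearMap.id * rightPairing φ (Coalgebra.comul (R := k) a)

variable {φ}

/-- Both pairings composed with `Δ` are algebra maps, and the identity of `H` intertwines them at
`a` and at `b`, hence at `a * b`. -/
theorem CommAt.mul {a b : H} (ha : CommAt φ a) (hb : CommAt φ b) : CommAt φ (a * b) := by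
  unfold CommAt at *
  rw [Bialgebra.comul_mul, map_mul, map_mul, mul_assoc, hb, ← mul_assoc, ha, mul_assoc]

theorem CommAt.add {a b : H} (ha : CommAt φ a) (hb : CommAt φ b) : CommAt φ (a + b) := by
  unfold CommAt at *
  rw [map_add, map_add, map_add, add_mul, mul_add, ha, hb]

theorem CommAt.algebraMap (t : k) : CommAt φ (algebraMap k H t) := by
  unfold CommAt
  rw [Bialgebra.comul_algebraMap, AlgHom.commutes, AlgHom.commutes]
  exact Algebra.commutes _ _

theorem isCoquasiTriangular_form
    (h : (pullAlg (Bialgebra.mulCoalgHom k H)).comp φ =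
      (dualMul φ).comp (Bialgebra.comulAlgHom k H)) (hc : ∀ a, CommAt φ a) :
    IsCoquasiTriangular (form φ.toLinearMap) where
  mul_left := pull_m12_form φ
  mul_right := pull_m23_form φ h
  comm := by
    apply WithConv.ext
    refine TensorProduct.ext' fun a b => ?_
    exact (scal_form_mul_prod φ a b).trans ((congrArg (fun f : WithConv (H →ₗ[k] H) => f b)
      (hc a)).trans (prodOp_mul_scal_form φ a b).symm)

end CQT

/-! ### Convolution on the generators of `E(n)` -/

namespace HopfE

variable {k : Type*} [Field k] {n : ℕ}

theorem x_anticomm (i j : Fin n) : x k i * x k j = -(x k j * x k i) := by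
  rcases lt_trichotomy i j with h | rfl | h
  · exact x_mul_x i j h
  · simp [x_mul_self]
  · rw [x_mul_x j i h, neg_neg]

section Conv

variable {A : Type*} [Ring A] [Algebra k A] (f g : WithConv (E k n →ₗ[k] A))

theorem conv_one : (f * g) 1 = f 1 * g 1 := by
  simp [Algebra.TensorProduct.one_def]

theorem conv_c : (f * g) (c k n) = f (c k n) * g (c k n) := by
  simp

theorem conv_x (i : Fin n) : (f * g) (x k i) = f 1 * g (x k i) + f (x k i) * g (c k n) := by
  simp

end Conv

/-! ### Characters and skew derivations -/

variable (k n) in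
/-- The character `c ↦ -1`, `x_i ↦ 0`. -/
def signHom : E k n →ₐ[k] k :=
  lift (-1) (fun _ => 0) (by simp) (by simp) (by simp) (by simp)

variable (k n) in
/-- The character `c ↦ -1`, `x_i ↦ 0`, in the dual algebra. -/
def sign : WithConv (E k n →ₗ[k] k) := toConv (signHom k n).toLinearMap

@[simp] theorem sign_one : sign k n 1 = 1 := map_one (signHom k n)
@[simp] theorem sign_c : sign k n (c k n) = -1 := lift_c _ _ _ _
@[simp] theorem sign_x (i : Fin n) : sign k n (x k i) = 0 := lift_x _ _ _ _ i

theorem sign_mul (a b : E k n) : sign k n (a * b) = sign k n a * sign k n b :=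
  map_mul (signHom k n) a b

/-- The representation `c ↦ diag(-1, 1)`, `x_j ↦ v_j E₀₁`. -/
def rep (v : Fin n → k) : E k n →ₐ[k] Matrix (Fin 2) (Fin 2) k :=
  lift !![-1, 0; 0, 1] (fun j => !![0, v j; 0, 0])
    (by simp [Matrix.one_fin_two])
    (fun j => by ext a b; fin_cases a <;> fin_cases b <;> simp)
    (fun j => by simp)
    (fun i j _ => by simp)

@[simp] theorem rep_c (v : Fin n → k) : rep v (c k n) = !![-1, 0; 0, 1] := lift_c _ _ _ _
@[simp] theorem rep_x (v : Fin n → k) (j : Fin n) : rep v (x k j) = !![0, v j; 0, 0] :=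
  lift_x _ _ _ _ j

/-- The representation is upper triangular with diagonal characters `sign` and `ε`. Its corner entry
is therefore a skew derivation with respect to these two characters. -/
theorem rep_entries (v : Fin n → k) (a : E k n) :
    rep v a 0 0 = sign k n a ∧ rep v a 1 0 = 0 ∧
      rep v a 1 1 = Coalgebra.counit (R := k) a := by
  induction a using induction with
  | h1 t => simp [sign, Matrix.algebraMap_matrix_apply]
  | hc => simp
  | hx i => simp
  | hm a b ha hb =>
    simp [Matrix.mul_apply, Fin.sum_univ_two, ha, hb, sign_mul]
  | ha a b ha hb => simp [ha, hb]

/-- The skew derivation vanishing on `c` with values `v_j` on `x_j`. -/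
def skew (v : Fin n → k) : WithConv (E k n →ₗ[k] k) :=
  toConv (LinearMap.proj (1 : Fin 2) ∘ₗ LinearMap.proj (0 : Fin 2) ∘ₗ (rep v).toLinearMap)

theorem skew_apply (v : Fin n → k) (a : E k n) : skew v a = rep v a 0 1 := rfl

@[simp] theorem skew_one (v : Fin n → k) : skew v 1 = 0 := by simp [skew_apply]
@[simp] theorem skew_c (v : Fin n → k) : skew v (c k n) = 0 := by simp [skew_apply]
@[simp] theorem skew_x (v : Fin n → k) (j : Fin n) : skew v (x k j) = v j := by simp [skew_apply]

theorem skew_mul (v : Fin n → k) (a b : E k n) :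
    skew v (a * b) = sign k n a * skew v b + skew v a * Coalgebra.counit (R := k) b := by
  simp [skew_apply, Matrix.mul_apply, Fin.sum_univ_two, rep_entries]

/-- A generalized skew derivation vanishing on the generators is zero. -/
theorem eq_zero_of_skew {f : WithConv (E k n →ₗ[k] k)} (g h : E k n → k)
    (hf : ∀ a b, f (a * b) = g a * f b + f a * h b) (h1 : f 1 = 0) (hc : f (c k n) = 0)
    (hx : ∀ i, f (x k i) = 0) : f = 0 := by
  ext a
  change f a = 0
  induction a using induction with
  | h1 t => rw [Algebra.algebraMap_eq_smul_one, map_smul, h1, smul_zero]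
  | hc => exact hc
  | hx i => exact hx i
  | hm a b ha hb => rw [hf, ha, hb, mul_zero, zero_mul, add_zero]
  | ha a b ha hb => rw [map_add, ha, hb, add_zero]

/-- The difference of two characters is a skew derivation, and here it vanishes on the generators.
-/
theorem sign_mul_sign : sign k n * sign k n = 1 := by
  rw [← sub_eq_zero]
  have e : ∀ b d, (sign k n * sign k n) (b * d) =
      (sign k n * sign k n) b * (sign k n * sign k n) d := fun b d => by
    have h := CQT.convMul_mul (f := sign k n) (g := sign k n) (f₁ := sign k n) (f₂ := sign k n)
      (g₁ := sign k n) (g₂ := sign k n) (f₃ := 0) (f₄ := 0) (g₃ := 0) (g₄ := 0)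
      (fun b d => by simp [sign_mul]) (fun b d => by simp [sign_mul]) b d
    simpa [-LinearMap.convMul_apply] using h
  have e' : ∀ b, (sign k n * sign k n - 1) b =
    (sign k n * sign k n) b - Coalgebra.counit (R := k) b := fun b => rfl
  refine eq_zero_of_skew (fun b => (sign k n * sign k n) b) (Coalgebra.counit (R := k))
    (fun b d => ?_) ?_ ?_ fun i => ?_
  · rw [e', e', e', e, Bialgebra.counit_mul]; ring
  · rw [e', conv_one]; simp
  · rw [e', conv_c]; simp
  · rw [e', conv_x]; simp

/-- As `sign` squares to `ε`, the anticommutator is a skew derivation for `ε` and `sign`. On `x_j`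
its value is `v_j - v_j`. -/
theorem sign_mul_skew (v : Fin n → k) : sign k n * skew v = -(skew v * sign k n) := by
  rw [← sub_eq_zero, sub_neg_eq_add]
  have e' : ∀ b, (sign k n * skew v + skew v * sign k n) b =
    (sign k n * skew v) b + (skew v * sign k n) b := fun b => rfl
  have e : ∀ b d, (sign k n * skew v + skew v * sign k n) (b * d) =
      Coalgebra.counit (R := k) b * (sign k n * skew v + skew v * sign k n) d +
        (sign k n * skew v + skew v * sign k n) b * sign k n d := fun b d => by
    have hs : ∀ b d : E k n, sign k n (b * d) = sign k n b * sign k n d +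
      (0 : WithConv (E k n →ₗ[k] k)) b * (0 : WithConv (E k n →ₗ[k] k)) d := fun b d => by
        simp [sign_mul]
    have hv : ∀ b d : E k n, skew v (b * d) = sign k n b * skew v d +
      skew v b * (1 : WithConv (E k n →ₗ[k] k)) d := skew_mul v
    rw [e', e', e', CQT.convMul_mul hs hv, CQT.convMul_mul hv hs, sign_mul_sign]
    simp [-LinearMap.convMul_apply]
    ring
  refine eq_zero_of_skew _ _ e ?_ ?_ fun i => ?_
  · rw [e', conv_one, conv_one]; simp
  · rw [e', conv_c, conv_c]; simp
  · rw [e', conv_x, conv_x]; simp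

/-- In the product rule for the anticommutator the mixed terms cancel by `sign_mul_skew`, leaving an
ordinary `ε`-derivation that vanishes on the generators. -/
theorem skew_mul_skew (v w : Fin n → k) : skew v * skew w = -(skew w * skew v) := by
  rw [← sub_eq_zero, sub_neg_eq_add]
  have e' : ∀ b, (skew v * skew w + skew w * skew v) b =
    (skew v * skew w) b + (skew w * skew v) b := fun b => rfl
  have e : ∀ b d, (skew v * skew w + skew w * skew v) (b * d) =
      Coalgebra.counit (R := k) b * (skew v * skew w + skew w * skew v) d +
        (skew v * skew w + skew w * skew v) b * Coalgebra.counit (R := k) d := fun b d => by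
    have hv : ∀ (v : Fin n → k) (b d : E k n), skew v (b * d) = sign k n b * skew v d +
      skew v b * (1 : WithConv (E k n →ₗ[k] k)) d := skew_mul
    rw [e', e', e', CQT.convMul_mul (hv v) (hv w), CQT.convMul_mul (hv w) (hv v), sign_mul_sign,
      sign_mul_skew, sign_mul_skew]
    have e'' : ∀ (f : WithConv (E k n →ₗ[k] k)) b, (-f) b = - f b := fun f b => rfl
    simp only [e'', mul_one, one_mul, LinearMap.convOne_apply, Algebra.algebraMap_self_apply]
    ring
  refine eq_zero_of_skew _ _ e ?_ ?_ fun i => ?_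
  · rw [e', conv_one, conv_one]; simp
  · rw [e', conv_c, conv_c]; simp
  · rw [e', conv_x, conv_x]; simp

/-- The algebra map `E(n) → E(n)^*` defined by a matrix. -/
def dualHom (hk : (2 : k) ≠ 0) (A : Matrix (Fin n) (Fin n) k) :
    E k n →ₐ[k] WithConv (E k n →ₗ[k] k) :=
  lift (sign k n) (fun i => skew (A i)) sign_mul_sign
    (fun i => by
      have h := skew_mul_skew (A i) (A i)
      rw [← sub_eq_zero, sub_neg_eq_add, ← two_smul k] at h
      -- Anticommutation with itself gives only `2 • (skew v * skew v) = 0`; characteristic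
      -- different from 2 gives the relation `x_i² = 0`.
      exact (smul_eq_zero.1 h).resolve_left hk)
    (fun i => sign_mul_skew _) (fun i j _ => skew_mul_skew _ _)

/-! ### A coquasi-triangular structure for every matrix -/

section Existence

variable (hk : (2 : k) ≠ 0) (A : Matrix (Fin n) (Fin n) k)

@[simp] theorem dualHom_c : dualHom hk A (c k n) = sign k n := lift_c _ _ _ _
@[simp] theorem dualHom_x (i : Fin n) : dualHom hk A (x k i) = skew (A i) := lift_x _ _ _ _ i

theorem pullAlg_mul_comp_dualHom :
    (CQT.pullAlg (Bialgebra.mulCoalgHom k (E k n))).comp (dualHom hk A) =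
      (CQT.dualMul (dualHom hk A)).comp (Bialgebra.comulAlgHom k (E k n)) := by
  refine algHom_ext ?_ fun i => ?_
  · apply WithConv.ext
    refine TensorProduct.ext' fun b d => ?_
    change dualHom hk A (c k n) (b * d) =
      CQT.dualMul (dualHom hk A) (Coalgebra.comul (R := k) (c k n)) (b ⊗ₜ d)
    rw [comul_c, CQT.dualMul_tmul, dualHom_c, sign_mul]
  · apply WithConv.ext
    refine TensorProduct.ext' fun b d => ?_
    change dualHom hk A (x k i) (b * d) =
      CQT.dualMul (dualHom hk A) (Coalgebra.comul (R := k) (x k i)) (b ⊗ₜ d)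
    rw [comul_x, map_add]
    change _ = CQT.dualMul (dualHom hk A) (1 ⊗ₜ x k i) (b ⊗ₜ d) +
      CQT.dualMul (dualHom hk A) (x k i ⊗ₜ c k n) (b ⊗ₜ d)
    rw [CQT.dualMul_tmul, CQT.dualMul_tmul, dualHom_c, dualHom_x, skew_mul, map_one]
    exact add_comm _ _

theorem sign_mul_add_zero (a b : E k n) : sign k n (a * b) = sign k n a * sign k n b +
    (0 : WithConv (E k n →ₗ[k] k)) a * (0 : WithConv (E k n →ₗ[k] k)) b := by
  simp [sign_mul]

theorem scalOne_sign_convMul_id_mul (a b : E k n) :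
    (CQT.scalOne k _ (sign k n) * toConv LinearMap.id : WithConv (E k n →ₗ[k] E k n)) (a * b) =
      (CQT.scalOne k _ (sign k n) * toConv LinearMap.id : WithConv (E k n →ₗ[k] E k n)) a *
        (CQT.scalOne k _ (sign k n) * toConv LinearMap.id : WithConv (E k n →ₗ[k] E k n)) b := by
  refine (CQT.scalOne_convMul_id_mul sign_mul_add_zero a b).trans ?_
  rw [map_zero, zero_mul]
  exact (congrArg _ (zero_mul (0 : E k n))).trans (add_zero _)

theorem id_convMul_scalOne_sign_mul (a b : E k n) :
    (toConv LinearMap.id * CQT.scalOne k _ (sign k n) : WithConv (E k n →ₗ[k] E k n)) (a * b) =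
      (toConv LinearMap.id * CQT.scalOne k _ (sign k n) : WithConv (E k n →ₗ[k] E k n)) a *
        (toConv LinearMap.id * CQT.scalOne k _ (sign k n) : WithConv (E k n →ₗ[k] E k n)) b := by
  refine (CQT.id_convMul_scalOne_mul sign_mul_add_zero a b).trans ?_
  rw [map_zero, mul_zero]
  exact (congrArg _ (zero_mul (0 : E k n))).trans (add_zero _)

/-- This is the commutation identity for left argument `c`. The maps `b ↦ ∑ sign(b₁) b₂` and `b ↦ ∑
b₁ sign(b₂)` are multiplicative, so it propagates from the generators to all `b`. -/
theorem c_mul_sign (b : E k n) :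
    c k n * (CQT.scalOne k _ (sign k n) * toConv LinearMap.id :
        WithConv (E k n →ₗ[k] E k n)) b =
      (toConv LinearMap.id * CQT.scalOne k _ (sign k n) :
        WithConv (E k n →ₗ[k] E k n)) b * c k n := by
  induction b using induction with
  | h1 t =>
    rw [Algebra.algebraMap_eq_smul_one, map_smul, map_smul, conv_one, conv_one]
    simp [CQT.scalOne_apply]
  | hc => rw [conv_c, conv_c]; simp [CQT.scalOne_apply]
  | hx i => rw [conv_x, conv_x]; simp [CQT.scalOne_apply, c_mul_x]
  | hm a b ha hb =>
    rw [scalOne_sign_convMul_id_mul, id_convMul_scalOne_sign_mul, ← mul_assoc, ha, mul_assoc, hb, mul_assoc]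
  | ha a b ha hb => rw [map_add, map_add, mul_add, add_mul, ha, hb]

/-- This is the commutation identity for left argument `x_i`, with `Δ(x_i) = 1 ⊗ x_i + x_i ⊗ c`
expanded. The inductive step is a twisted Leibniz rule in which `c_mul_sign` moves `c` past the
first factor. -/
theorem x_mul_add_skew (v : Fin n → k) (i : Fin n) (b : E k n) :
    x k i * b + c k n * (CQT.scalOne k _ (skew v) * toConv LinearMap.id :
        WithConv (E k n →ₗ[k] E k n)) b =
      (toConv LinearMap.id * CQT.scalOne k _ (skew v) : WithConv (E k n →ₗ[k] E k n)) b +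
        (toConv LinearMap.id * CQT.scalOne k _ (sign k n) :
          WithConv (E k n →ₗ[k] E k n)) b * x k i := by
  have hv : ∀ b d : E k n, skew v (b * d) = sign k n b * skew v d +
      skew v b * (1 : WithConv (E k n →ₗ[k] k)) d := skew_mul v
  induction b using induction with
  | h1 t =>
    rw [Algebra.algebraMap_eq_smul_one, map_smul, map_smul, map_smul, conv_one, conv_one, conv_one]
    simp [CQT.scalOne_apply]
  | hc => rw [conv_c, conv_c, conv_c]; simp [CQT.scalOne_apply, c_mul_x]
  | hx j =>
    rw [conv_x, conv_x, conv_x]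
    simp only [CQT.scalOne_apply, LinearMap.id_apply, skew_one, skew_x, skew_c,
      sign_x, sign_c, map_zero, map_neg, map_one, zero_mul, mul_zero, zero_add, add_zero, one_mul,
      ← Algebra.smul_def, mul_smul_comm, c_mul_c, x_anticomm i j, mul_neg, mul_one, neg_mul]
    rw [Algebra.algebraMap_eq_smul_one]
    abel
  | hm a b ha hb =>
    have hc := c_mul_sign a
    rw [CQT.scalOne_convMul_id_mul hv, id_convMul_scalOne_sign_mul, CQT.id_convMul_scalOne_mul hv]
    simp only [map_one, one_mul, mul_one, LinearMap.id_apply]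
    set G := (CQT.scalOne k _ (sign k n) * toConv LinearMap.id : WithConv (E k n →ₗ[k] E k n))
    set G' := (toConv LinearMap.id * CQT.scalOne k _ (sign k n) : WithConv (E k n →ₗ[k] E k n))
    set X := (CQT.scalOne k _ (skew v) * toConv LinearMap.id : WithConv (E k n →ₗ[k] E k n))
    set X' := (toConv LinearMap.id * CQT.scalOne k _ (skew v) : WithConv (E k n →ₗ[k] E k n))
    calc x k i * (a * b) + c k n * (G a * X b + X a * b)
        = (x k i * a + c k n * X a) * b + (c k n * G a) * X b := by noncomm_ring
      _ = X' a * b + G' a * (x k i * b + c k n * X b) := by rw [ha, hc]; noncomm_ring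
      _ = _ := by rw [hb]; noncomm_ring
  | ha a b ha hb =>
    simp only [map_add, mul_add, add_mul]
    rw [add_add_add_comm, ha, hb, add_add_add_comm]

theorem commAt_dualHom (a : E k n) : CQT.CommAt (dualHom hk A) a := by
  induction a using induction with
  | h1 t => exact CQT.CommAt.algebraMap t
  | hc =>
    unfold CQT.CommAt
    ext b
    rw [comul_c, CQT.leftPairing_tmul, CQT.rightPairing_tmul, dualHom_c,
      (CQT.scalOne_commute_cst (sign k n) (c k n)).eq,
      ← (CQT.scalOne_commute_cst (sign k n) (c k n)).eq, ← mul_assoc, CQT.mul_cst,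
      (CQT.scalOne_commute_cst (sign k n) (c k n)).eq, mul_assoc, CQT.cst_mul, c_mul_sign]
  | hx i =>
    have e1 : CQT.leftPairing (dualHom hk A) (1 ⊗ₜ x k i + x k i ⊗ₜ c k n) =
        CQT.cst k (x k i) + CQT.cst k (c k n) * CQT.scalOne k _ (skew (A i)) := by
      rw [map_add, CQT.leftPairing_tmul, CQT.leftPairing_tmul, dualHom_x, map_one, map_one,
        one_mul, (CQT.scalOne_commute_cst (skew (A i)) (c k n)).eq]
    have e2 : CQT.rightPairing (dualHom hk A) (1 ⊗ₜ x k i + x k i ⊗ₜ c k n) =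
        CQT.scalOne k _ (skew (A i)) + CQT.scalOne k _ (sign k n) * CQT.cst k (x k i) := by
      rw [map_add, CQT.rightPairing_tmul, CQT.rightPairing_tmul, dualHom_x, dualHom_c, map_one,
        one_mul, (CQT.scalOne_commute_cst (sign k n) (x k i)).eq]
    unfold CQT.CommAt
    rw [comul_x, e1, e2, add_mul, mul_add, mul_assoc (CQT.cst k (c k n)),
      ← mul_assoc _ (CQT.scalOne k _ (sign k n))]
    ext b
    refine Eq.trans ?_ ((x_mul_add_skew (A i) i b).trans ?_)
    · exact congrArg₂ (· + ·) (CQT.cst_mul (x k i) (toConv LinearMap.id) b)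
        (CQT.cst_mul (c k n) (CQT.scalOne k _ (skew (A i)) * toConv LinearMap.id) b)
    · exact congrArg₂ (· + ·) rfl
        (CQT.mul_cst (x k i) (toConv LinearMap.id * CQT.scalOne k _ (sign k n)) b).symm
  | hm a b ha hb => exact ha.mul hb
  | ha a b ha hb => exact ha.add hb

/-- The coquasi-triangular structure with matrix `A`. -/
def ofMatrix : CQT.CoquasiTriangular k (E k n) :=
  ⟨CQT.unitForm (dualHom hk A),
    CQT.isCoquasiTriangular_form (pullAlg_mul_comp_dualHom hk A) (commAt_dualHom hk A)⟩

@[simp] theorem matrix_ofMatrix : matrix (ofMatrix hk A) = A := by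
  ext i j
  change dualHom hk A (x k i) (x k j) = A i j
  rw [dualHom_x, skew_x]

end Existence

/-! ### Values on the generators -/

section Values

variable {A : Type*} [Ring A] [Algebra k A]
  (f g : WithConv (E k n ⊗[k] E k n →ₗ[k] A))

theorem conv_c_x (j : Fin n) : (f * g) (c k n ⊗ₜ x k j) =
    f (c k n ⊗ₜ 1) * g (c k n ⊗ₜ x k j) + f (c k n ⊗ₜ x k j) * g (c k n ⊗ₜ c k n) := by
  simp [TensorProduct.tmul_add, TensorProduct.comul_tmul]

theorem conv_x_c (i : Fin n) : (f * g) (x k i ⊗ₜ c k n) =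
    f (1 ⊗ₜ c k n) * g (x k i ⊗ₜ c k n) + f (x k i ⊗ₜ c k n) * g (c k n ⊗ₜ c k n) := by
  simp [TensorProduct.add_tmul, TensorProduct.comul_tmul]

theorem conv_one_one : (f * g) (1 ⊗ₜ 1) = f (1 ⊗ₜ 1) * g (1 ⊗ₜ 1) := by
  simp [TensorProduct.comul_tmul, Algebra.TensorProduct.one_def]

theorem conv_x_x (i j : Fin n) : (f * g) (x k i ⊗ₜ x k j) =
    f (1 ⊗ₜ 1) * g (x k i ⊗ₜ x k j) + f (1 ⊗ₜ x k j) * g (x k i ⊗ₜ c k n) +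
      f (x k i ⊗ₜ 1) * g (c k n ⊗ₜ x k j) + f (x k i ⊗ₜ x k j) * g (c k n ⊗ₜ c k n) := by
  simp [TensorProduct.comul_tmul, TensorProduct.add_tmul, TensorProduct.tmul_add]
  abel

end Values

/-- The triangular representation with all `v_j = 1` separates the terms: the corner entry gives `s
= t`, and the first diagonal entry gives `u = -u`. -/
theorem eq_of_smul_x_mul_c (hk : (2 : k) ≠ 0) (i : Fin n) {s t u : k}
    (h : s • (x k i * c k n) + u • 1 = u • c k n + t • (x k i * c k n)) : u = 0 ∧ s = t := by
  have h' := congrArg (rep (fun _ => (1 : k))) h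
  simp only [map_add, map_smul, map_mul, map_one, rep_x, rep_c] at h'
  have h00 := congrFun (congrFun h' 0) 0
  have h01 := congrFun (congrFun h' 0) 1
  simp at h00 h01
  refine ⟨?_, h01⟩
  have : (2 : k) * u = 0 := by linear_combination h00
  exact (mul_eq_zero.1 this).resolve_left hk

/-! ### Rigidity: the matrix determines the structure -/

section CoquasiTriangular

variable {r : (CQT.Form2 k (E k n))ˣ}
  (hr : CQT.IsCoquasiTriangular (r : CQT.Form2 k (E k n)))

include hr

theorem cqt_one_tmul (b : E k n) :
    (r : CQT.Form2 k (E k n)) (1 ⊗ₜ b) = Coalgebra.counit (R := k) b :=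
  congrArg (fun f : WithConv (E k n →ₗ[k] k) => f b) (CQT.row_one hr)

theorem cqt_tmul_one (b : E k n) :
    (r : CQT.Form2 k (E k n)) (b ⊗ₜ 1) = Coalgebra.counit (R := k) b :=
  congrArg (fun f : WithConv (E k n →ₗ[k] k) => f b) (CQT.col_one hr)

theorem cqt_c_x_aux (hk : (2 : k) ≠ 0) (j : Fin n) :
    (r : CQT.Form2 k (E k n)) (c k n ⊗ₜ x k j) = 0 ∧
      -1 = (r : CQT.Form2 k (E k n)) (c k n ⊗ₜ c k n) := by
  have h := congrArg (fun f : WithConv (E k n ⊗[k] E k n →ₗ[k] E k n) => f (c k n ⊗ₜ x k j)) hr.comm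
  simp only [conv_c_x, CQT.scal_apply, cqt_tmul_one hr, CQT.prod, CQT.prodOp,
    LinearMap.comp_apply, LinearMap.mul'_apply, counit_c, map_one, one_mul, c_mul_c] at h
  change c k n * x k j + _ * 1 = LinearMap.mul' k _ (1 ⊗ₜ c k n) * _ +
    LinearMap.mul' k _ (x k j ⊗ₜ c k n) * _ at h
  simp only [LinearMap.mul'_apply, one_mul, ← Algebra.commutes, c_mul_x] at h
  refine eq_of_smul_x_mul_c hk j ?_
  simpa only [Algebra.smul_def, mul_one, map_neg, map_one, neg_mul, one_mul] using h

theorem cqt_x_c (hk : (2 : k) ≠ 0) (i : Fin n) :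
    (r : CQT.Form2 k (E k n)) (x k i ⊗ₜ c k n) = 0 := by
  have h := congrArg (fun f : WithConv (E k n ⊗[k] E k n →ₗ[k] E k n) => f (x k i ⊗ₜ c k n)) hr.comm
  simp only [conv_x_c, CQT.scal_apply, cqt_one_tmul hr, CQT.prod, CQT.prodOp,
    LinearMap.comp_apply, LinearMap.mul'_apply, counit_c, map_one, one_mul, c_mul_c] at h
  change x k i * c k n + _ * 1 = LinearMap.mul' k _ (c k n ⊗ₜ 1) * _ +
    LinearMap.mul' k _ (c k n ⊗ₜ x k i) * _ at h
  simp only [LinearMap.mul'_apply, mul_one, ← Algebra.commutes, c_mul_x] at h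
  refine (eq_of_smul_x_mul_c hk i (s := 1) (t := -(r : CQT.Form2 k (E k n)) (c k n ⊗ₜ c k n)) ?_).1
  simpa only [Algebra.smul_def, mul_one, map_neg, map_one, neg_mul, one_mul, mul_neg] using h

theorem cqt_tmul_mul (a b d : E k n) :
    (r : CQT.Form2 k (E k n)) (a ⊗ₜ (b * d)) =
      (CQT.col (r : CQT.Form2 k (E k n)) d * CQT.col (r : CQT.Form2 k (E k n)) b) a :=
  congrArg (fun f : WithConv (E k n →ₗ[k] k) => f a) (CQT.pull_m23_eq_iff.1 hr.mul_right b d)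

variable (hk : (2 : k) ≠ 0) (hn : 1 ≤ n)

include hk hn

/-- Here `n ≥ 1` matters: it is the relation with some `x_j` that fixes the sign. -/
theorem cqt_c_c : (r : CQT.Form2 k (E k n)) (c k n ⊗ₜ c k n) = -1 :=
  (cqt_c_x_aux hr hk ⟨0, hn⟩).2.symm

theorem row_c_eq : CQT.row (r : CQT.Form2 k (E k n)) (c k n) = sign k n := by
  ext b
  change (r : CQT.Form2 k (E k n)) (c k n ⊗ₜ b) = sign k n b
  induction b using induction with
  | h1 t =>
    rw [Algebra.algebraMap_eq_smul_one, TensorProduct.tmul_smul, map_smul, map_smul,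
      cqt_tmul_one hr, counit_c, sign_one]
  | hc => rw [cqt_c_c hr hk hn, sign_c]
  | hx i => rw [(cqt_c_x_aux hr hk i).1, sign_x]
  | hm a b ha hb =>
    rw [cqt_tmul_mul hr, conv_c, CQT.col_apply, CQT.col_apply, ha, hb, sign_mul, mul_comm]
  | ha a b ha hb => rw [TensorProduct.tmul_add, map_add, map_add, ha, hb]

/-- Inserting `Δ(x_i)` into the second identity gives exactly the product rule of `skew`, once the
functional of `c` is known to be `sign`. -/
theorem row_x_eq (i : Fin n) : CQT.row (r : CQT.Form2 k (E k n)) (x k i) =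
    skew fun j => (r : CQT.Form2 k (E k n)) (x k i ⊗ₜ x k j) := by
  ext b
  change (r : CQT.Form2 k (E k n)) (x k i ⊗ₜ b) = skew _ b
  induction b using induction with
  | h1 t =>
    rw [Algebra.algebraMap_eq_smul_one, TensorProduct.tmul_smul, map_smul, map_smul,
      cqt_tmul_one hr, counit_x, skew_one]
  | hc => rw [cqt_x_c hr hk, skew_c]
  | hx j => rw [skew_x]
  | hm a b ha hb =>
    have hc : (r : CQT.Form2 k (E k n)) (c k n ⊗ₜ a) = sign k n a :=
      congrArg (fun f : WithConv (E k n →ₗ[k] k) => f a) (row_c_eq hr hk hn)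
    rw [cqt_tmul_mul hr, conv_x, CQT.col_apply, CQT.col_apply, CQT.col_apply, CQT.col_apply, ha, hb,
      hc, cqt_one_tmul hr, skew_mul]
    ring
  | ha a b ha hb => rw [TensorProduct.tmul_add, map_add, map_add, ha, hb]

end CoquasiTriangular

theorem matrix_injective (hk : (2 : k) ≠ 0) (hn : 1 ≤ n) :
    Function.Injective (matrix : CQT.CoquasiTriangular k (E k n) → Matrix (Fin n) (Fin n) k) := by
  intro r s h
  have key : ∀ a, CQT.row (r.1 : CQT.Form2 k (E k n)) a =
      CQT.row (s.1 : CQT.Form2 k (E k n)) a := by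
    intro a
    induction a using induction with
    | h1 t =>
      have e : ∀ f : CQT.Form2 k (E k n), CQT.row f (algebraMap k _ t) = t • CQT.row f 1 :=
        fun f => by
          ext b
          change f (_ ⊗ₜ b) = t • f (1 ⊗ₜ b)
          rw [Algebra.algebraMap_eq_smul_one, ← TensorProduct.smul_tmul', map_smul]
      rw [e, e, CQT.row_one r.2, CQT.row_one s.2]
    | hc => rw [row_c_eq r.2 hk hn, row_c_eq s.2 hk hn]
    | hx i =>
      rw [row_x_eq r.2 hk hn, row_x_eq s.2 hk hn]
      exact congrArg skew (congrFun h i)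
    | hm a b ha hb =>
      rw [CQT.pull_m12_eq_iff.1 r.2.mul_left, CQT.pull_m12_eq_iff.1 s.2.mul_left, ha, hb]
    | ha a b ha hb =>
      have e : ∀ f : CQT.Form2 k (E k n), CQT.row f (a + b) = CQT.row f a + CQT.row f b :=
        fun f => by
          ext d
          change f (_ ⊗ₜ d) = f (a ⊗ₜ d) + f (b ⊗ₜ d)
          rw [TensorProduct.add_tmul, map_add]
      rw [e, e, ha, hb]
  refine Subtype.ext (Units.ext (WithConv.ext (TensorProduct.ext' fun a b => ?_)))
  exact congrArg (fun f : WithConv (E k n →ₗ[k] k) => f b) (key a)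

/-! ### Lazy cocycles -/

section Lazy

theorem lazy_c_x (hk : (2 : k) ≠ 0) {σ : CQT.Form2 k (E k n)} (hσ : CQT.IsLazy σ) (j : Fin n) :
    σ (c k n ⊗ₜ x k j) = 0 ∧ σ (c k n ⊗ₜ 1) = σ (c k n ⊗ₜ c k n) := by
  have h := congrArg (fun f : WithConv (E k n ⊗[k] E k n →ₗ[k] E k n) => f (c k n ⊗ₜ x k j)) hσ
  simp only [conv_c_x, CQT.scal_apply, CQT.prod, LinearMap.mul'_apply, mul_one, c_mul_c, c_mul_x,
    ← Algebra.commutes] at h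
  have h' := eq_of_smul_x_mul_c hk j (s := -σ (c k n ⊗ₜ 1)) (t := -σ (c k n ⊗ₜ c k n))
    (u := σ (c k n ⊗ₜ x k j))
    (by simpa only [Algebra.smul_def, mul_one, map_neg, neg_mul, mul_neg] using h)
  exact ⟨h'.1, neg_injective h'.2⟩

theorem conv_c_one (f g : CQT.Form2 k (E k n)) :
    (f * g) (c k n ⊗ₜ 1) = f (c k n ⊗ₜ 1) * g (c k n ⊗ₜ 1) := by
  simp [TensorProduct.comul_tmul, Algebra.TensorProduct.one_def]

theorem unit_c_one_ne_zero (σ : (CQT.Form2 k (E k n))ˣ) :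
    (σ : CQT.Form2 k (E k n)) (c k n ⊗ₜ 1) ≠ 0 := by
  intro h
  have h1 := congrArg (fun f : CQT.Form2 k (E k n) => f (c k n ⊗ₜ 1)) σ.mul_inv
  simp only [conv_c_one, h, zero_mul] at h1
  simp [TensorProduct.counit_tmul] at h1

/-- The cocycle identity at `(c, 1, 1)` reads `σ(c ⊗ 1)² = σ(1 ⊗ 1) σ(c ⊗ 1)`. Cocycles are not
assumed normalized, so `σ(1 ⊗ 1)` remains as a factor below. -/
theorem cocycle_c_one {σ : (CQT.Form2 k (E k n))ˣ}
    (hσ : CQT.IsLeftCocycle (σ : CQT.Form2 k (E k n))) :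
    (σ : CQT.Form2 k (E k n)) (c k n ⊗ₜ 1) = (σ : CQT.Form2 k (E k n)) (1 ⊗ₜ 1) := by
  have h := congrArg (fun f : WithConv ((E k n ⊗[k] E k n) ⊗[k] E k n →ₗ[k] k) =>
    f ((c k n ⊗ₜ 1) ⊗ₜ 1)) hσ
  have e : ∀ f g : WithConv ((E k n ⊗[k] E k n) ⊗[k] E k n →ₗ[k] k),
      (f * g) ((c k n ⊗ₜ 1) ⊗ₜ 1) = f ((c k n ⊗ₜ 1) ⊗ₜ 1) * g ((c k n ⊗ₜ 1) ⊗ₜ 1) := by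
    intro f g
    simp [TensorProduct.comul_tmul, Algebra.TensorProduct.one_def]
  simp only [e, CQT.pull_apply, CQT.p12_tmul, CQT.p23_tmul, CQT.m12_tmul, CQT.m23_tmul,
    Bialgebra.counit_one, counit_c, one_smul, mul_one] at h
  exact mul_right_cancel₀ (unit_c_one_ne_zero σ) h

end Lazy

/-! ### The action on matrices and its orbits -/

theorem twist_x_x (hk : (2 : k) ≠ 0) (hn : 1 ≤ n) {σ r : (CQT.Form2 k (E k n))ˣ}
    (hσ : σ ∈ CQT.lazyCocycles k (E k n)) (hr : CQT.IsCoquasiTriangular (r : CQT.Form2 k (E k n)))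
    (i j : Fin n) :
    (σ : CQT.Form2 k (E k n)) (1 ⊗ₜ 1) *
        ((CQT.twist σ r : (CQT.Form2 k (E k n))ˣ) : CQT.Form2 k (E k n)) (x k i ⊗ₜ x k j) =
      (σ : CQT.Form2 k (E k n)) (1 ⊗ₜ 1) * (r : CQT.Form2 k (E k n)) (x k i ⊗ₜ x k j) -
        ((σ : CQT.Form2 k (E k n)) (x k i ⊗ₜ x k j) +
          (σ : CQT.Form2 k (E k n)) (x k j ⊗ₜ x k i)) := by
  have hr' := CQT.twist_isCoquasiTriangular hσ hr
  -- Multiplying by `σ` on the right avoids computing values of `σ⁻¹`.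
  have e : CQT.twist σ r * σ = Units.map (CQT.pull (CQT.flip k (E k n))) σ * r := by
    simp [CQT.twist]
  have h := congrArg (fun f : (CQT.Form2 k (E k n))ˣ =>
    (f : CQT.Form2 k (E k n)) (x k i ⊗ₜ x k j)) e
  simp only [Units.val_mul, Units.coe_map] at h
  rw [conv_x_x, conv_x_x] at h
  simp only [CQT.pull_apply, CQT.flip_tmul, cqt_one_tmul hr', cqt_tmul_one hr',
    counit_x, Bialgebra.counit_one, cqt_x_c hr hk, (cqt_c_x_aux hr hk j).1, cqt_c_c hr hk hn,
    ← (lazy_c_x hk hσ.2 j).2, cocycle_c_one hσ.1, one_mul, zero_mul, mul_zero, add_zero] at h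
  linear_combination h

theorem matrix_smul (hk : (2 : k) ≠ 0) (hn : 1 ≤ n) (σ : CQT.lazyCocycles k (E k n))
    (r : CQT.CoquasiTriangular k (E k n)) :
    matrix (σ • r) - (matrix (σ • r)).transpose = matrix r - (matrix r).transpose := by
  have hs : (σ.1 : CQT.Form2 k (E k n)) (1 ⊗ₜ 1) ≠ 0 := by
    rw [← cocycle_c_one σ.2.1]
    exact unit_c_one_ne_zero _
  ext i j
  refine mul_left_cancel₀ hs ?_
  have h1 := twist_x_x hk hn σ.2 r.2 i j
  have h2 := twist_x_x hk hn σ.2 r.2 j i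
  change _ * (((CQT.twist σ.1 r.1 : (CQT.Form2 k (E k n))ˣ) : CQT.Form2 k (E k n)) (x k i ⊗ₜ x k j) -
    ((CQT.twist σ.1 r.1 : (CQT.Form2 k (E k n))ˣ) : CQT.Form2 k (E k n)) (x k j ⊗ₜ x k i)) =
    _ * ((r.1 : CQT.Form2 k (E k n)) (x k i ⊗ₜ x k j) -
      (r.1 : CQT.Form2 k (E k n)) (x k j ⊗ₜ x k i))
  linear_combination h1 - h2

theorem exists_smul_eq (hk : (2 : k) ≠ 0) (hn : 1 ≤ n) {r s : CQT.CoquasiTriangular k (E k n)}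
    (h : matrix s - (matrix s).transpose = matrix r - (matrix r).transpose) :
    ∃ σ : CQT.lazyCocycles k (E k n), σ • r = s := by
  -- Equal skew parts make `matrix r - matrix s` symmetric, so `B + Bᵗ` is exactly the matrix the
  -- action has to subtract.
  let B := (2 : k)⁻¹ • (matrix r - matrix s)
  have hB : ∀ i j, B i j + B j i = matrix r i j - matrix s i j := fun i j => by
    have hij := congrFun (congrFun h i) j
    simp only [Matrix.sub_apply, Matrix.transpose_apply] at hij
    simp only [B, Matrix.smul_apply, Matrix.sub_apply, smul_eq_mul]
    field_simp
    linear_combination hij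
  -- With base point of matrix zero, the values of `p⁻¹ * q` on `x_i ⊗ x_j` are those of `q`, namely
  -- `B`.
  let p := ofMatrix hk (0 : Matrix (Fin n) (Fin n) k)
  let q := ofMatrix hk B
  have hσ := CQT.inv_mul_mem_lazyCocycles q.2 p.2
  set τ := p.1⁻¹ * q.1 with hτ
  have e : p.1 * τ = q.1 := by simp [hτ]
  have e1 : (τ : CQT.Form2 k (E k n)) (1 ⊗ₜ 1) = 1 := by
    have h := congrArg (fun f : (CQT.Form2 k (E k n))ˣ => (f : CQT.Form2 k (E k n)) (1 ⊗ₜ 1)) e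
    simp only [Units.val_mul] at h
    rw [conv_one_one] at h
    simpa only [cqt_one_tmul p.2, cqt_one_tmul q.2, Bialgebra.counit_one, one_mul] using h
  have e2 : ∀ i j, (τ : CQT.Form2 k (E k n)) (x k i ⊗ₜ x k j) = B i j := fun i j => by
    have h := congrArg (fun f : (CQT.Form2 k (E k n))ˣ =>
      (f : CQT.Form2 k (E k n)) (x k i ⊗ₜ x k j)) e
    have hp : (p.1 : CQT.Form2 k (E k n)) (x k i ⊗ₜ x k j) = 0 :=
      congrFun (congrFun (matrix_ofMatrix hk (0 : Matrix (Fin n) (Fin n) k)) i) j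
    have hq : (q.1 : CQT.Form2 k (E k n)) (x k i ⊗ₜ x k j) = B i j :=
      congrFun (congrFun (matrix_ofMatrix hk B) i) j
    simp only [Units.val_mul] at h
    rw [conv_x_x] at h
    simpa only [cqt_one_tmul p.2, cqt_tmul_one p.2, hp, hq, Bialgebra.counit_one, counit_x,
      one_mul, zero_mul, add_zero] using h
  refine ⟨⟨τ, hσ⟩, matrix_injective hk hn ?_⟩
  ext i j
  have h1 := twist_x_x hk hn hσ r.2 i j
  rw [e1, one_mul, one_mul, e2, e2, hB] at h1
  exact h1.trans (sub_sub_cancel _ _)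

end HopfE

end

theorem mainTheorem8 (k : Type*) [Field k] (hk : ringChar k ≠ 2) (n : ℕ) (hn : 1 ≤ n) :
    Function.Bijective
      (HopfE.matrix : CQT.CoquasiTriangular k (HopfE.E k n) → Matrix (Fin n) (Fin n) k) ∧
    ∃ Φ : MulAction.orbitRel.Quotient (CQT.lazyCocycles k (HopfE.E k n))
          (CQT.CoquasiTriangular k (HopfE.E k n)) ≃
        {S : Matrix (Fin n) (Fin n) k // S.transpose = -S},
      ∀ r : CQT.CoquasiTriangular k (HopfE.E k n),
        (Φ (Quotient.mk (MulAction.orbitRel (CQT.lazyCocycles k (HopfE.E k n))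
            (CQT.CoquasiTriangular k (HopfE.E k n))) r) : Matrix (Fin n) (Fin n) k) =
          (2 : k)⁻¹ • (HopfE.matrix r - (HopfE.matrix r).transpose) := by
  have h2 : (2 : k) ≠ 0 := Ring.two_ne_zero hk
  refine ⟨⟨HopfE.matrix_injective h2 hn, fun A => ⟨HopfE.ofMatrix h2 A, HopfE.matrix_ofMatrix h2 A⟩⟩,
    ?_⟩
  let F : MulAction.orbitRel.Quotient (CQT.lazyCocycles k (HopfE.E k n))
      (CQT.CoquasiTriangular k (HopfE.E k n)) →
        {S : Matrix (Fin n) (Fin n) k // S.transpose = -S} :=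
    Quotient.lift (fun r => ⟨(2 : k)⁻¹ • (HopfE.matrix r - (HopfE.matrix r).transpose), by
      rw [Matrix.transpose_smul, Matrix.transpose_sub, Matrix.transpose_transpose, ← smul_neg,
        neg_sub]⟩) (by
      rintro _ r ⟨σ, rfl⟩
      refine Subtype.ext ?_
      exact congrArg (fun M : Matrix (Fin n) (Fin n) k => (2 : k)⁻¹ • M)
        (HopfE.matrix_smul h2 hn σ r))
  refine ⟨Equiv.ofBijective F ⟨?_, ?_⟩, fun r => rfl⟩
  · rintro ⟨r⟩ ⟨s⟩ h
    obtain ⟨σ, hσ⟩ := HopfE.exists_smul_eq h2 hn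
      (smul_right_injective _ (inv_ne_zero h2) (congrArg Subtype.val h))
    exact Quotient.sound ⟨σ, hσ⟩
  · rintro ⟨S, hS⟩
    -- A skew-symmetric matrix is its own skew part.
    refine ⟨Quotient.mk _ (HopfE.ofMatrix h2 S), Subtype.ext ?_⟩
    change (2 : k)⁻¹ • (HopfE.matrix (HopfE.ofMatrix h2 S) -
      (HopfE.matrix (HopfE.ofMatrix h2 S)).transpose) = S
    rw [HopfE.matrix_ofMatrix, hS, sub_neg_eq_add, ← two_smul k, smul_smul, inv_mul_cancel₀ h2,
      one_smul]
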